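/- Let $p$ be a prime, $K$ a field of characteristic $p$, $a \geq 1$, $q = p^a$, and $\sigma(c) = c^q$ on $K$. Let $K[X,\sigma]$ be the skew polynomial ring, in which $X c = \sigma(c) X$. A $\varphi$-module is a finite-dimensional $K$-vector space $D$ with a $\sigma$-semilinear map $\varphi : D \to D$; it is simple if $D \neq 0$ and $0$, $D$ are its only $\varphi$-stable subspaces. For $P = \sum_n c_n X^n \in K[X,\sigma]$ and $x \in D$ put $P(\varphi)(x) = \sum_n c_n \varphi^n(x)$. For $d \geq 0$ let $R_d = K[(a_{ij})_{1\le i,j\le d}, (x_i)_{1\le i\le d}]$, let $v_0 = (x_1,\dots,x_d)^T \in R_d^d$ and $v_{n+1} = (a_{ij}) \cdot v_n^{(q)}$, where $v^{(q)}$ raises every coordinate of $v$ to the power $q$. There is a unique family $P_0,\dots,P_{d-1} \in R_d$ with $v_d = \sum_{i=0}^{d-1} P_i v_i$. If $D$ is a $\varphi$-module with a basis $\mathcal B$ of cardinality $d$, $G$ is the matrix of $\varphi$ in $\mathcal B$ and $\xi$ is the coordinate vector of $x \in D$, the semi-characteristic polynomial of $\varphi$ in $x$ is $\chi_{\varphi,x}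 = \chi_{\varphi,x,\mathcal B} = X^d - \sum_{i=0}^{d-1} P_i(G,\xi) X^i \in K[X,\sigma]$. Theorem. The families $(P_i)$ above exist and are unique for all $d \ge 0$. Let $(D,\varphi)$ be a $\varphi$-module. (1) Let $0 = D_m \subset \dots \subset D_0 = D$ be a Jordan–Hölder sequence of $D$ (a chain of $\varphi$-stable subspaces such that every $D_i/D_{i+1}$ is a simple $\varphi$-module), let $\overline{\varphi_i}$ be the map induced by $\varphi$ on $D_i/D_{i+1}$, and let $x \in D$. Then there are $y_i \in D_i/D_{i+1}$ and $\pi_i \in K[X,\sigma]$ ($0 \le i \le m-1$) such that, for all choices of bases of $D$ and of the $D_i/D_{i+1}$, $$\chi_{\varphi,x} = \pi_{m-1}\cdots\pi_0, \qquad \pi_i = \chi_{\overline{\varphi_i},y_i}.$$ One can take $y_i$ to be the class of $(\pi_{i-1}\cdots\pi_0)(\varphi)(x)$, which lies in $D_i$; for this choice, $\pi_i$ is irreducible in $K[X,\sigma]$ for every $i$ such that $y_i \neq 0$ or $\dim_K D_i/D_{i+1} = 1$. If $x$ generates $D$ (that is, the $\varphi^n(x)$, $n \ge 0$, span $D$ over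 $K$), then every $y_i$ is nonzero, and hence every $\pi_i$ is irreducible. (2) If $x$ generates $D$, then for every $m \ge 0$ the map sending a Jordan–Hölder sequence $(D_i)_{0 \le i \le m}$ of $D$ to the tuple $(\pi_{m-1},\dots,\pi_0)$ given by the choice of the $y_i$ in (1) is a bijection from the Jordan–Hölder sequences of length $m$ of $D$ onto the factorizations of $\chi_{\varphi,x}$ as an ordered product of $m$ monic irreducible elements of $K[X,\sigma]$. -/

import Mathlib

noncomputable section

namespace PhiModule

/-! ### Skew polynomials `K[X, σ]`, `σ = (c ↦ c ^ (p ^ a))` -/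

section Skew

variable (K : Type*) [Field K] (p a : ℕ) [Fact p.Prime] [CharP K p]

/-- The action of `(ℕ, +)` on `K` by the powers of `σ = (c ↦ c ^ (p ^ a))`. -/
@[reducible]
def frobAction : MulSemiringAction (Multiplicative ℕ) K :=
  MulSemiringAction.compHom K (powersHom (K →+* K) (iterateFrobenius K p a))

/-- The skew polynomial ring `K[X, σ]`, in which `X * c = σ(c) * X`: Mathlib's skew polynomials
for the action of the powers of `σ`. -/
def SkewPoly (K : Type*) [Field K] (p a : ℕ) [Fact p.Prime] [CharP K p] : Type _ :=
  SkewPolynomial K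

instance : Ring (SkewPoly K p a) := @SkewPolynomial.instRing K _ (frobAction K p a)

variable {K p a}

namespace SkewPoly

/-- The skew polynomial `c * X ^ n`. -/
def monomial (n : ℕ) (c : K) : SkewPoly K p a := SkewPolynomial.monomial n c

/-- The coefficient of `X ^ n` (coefficients are written on the left). -/
def coeff (P : SkewPoly K p a) (n : ℕ) : K := SkewPolynomial.coeff P n

/-- A skew polynomial is monic if its leading coefficient is `1`. -/
def Monic (P : SkewPoly K p a) : Prop := ∃ n : ℕ, P.coeff n = 1 ∧ ∀ k, n < k → P.coeff k = 0

theorem monomial_mul_monomial (m n : ℕ) (c e : K) :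
    (monomial m c * monomial n e : SkewPoly K p a) =
      monomial (m + n) (c * (e ^ ((p ^ a) ^ m))) := by
  let _ := frobAction K p a
  have h : ∀ (m : ℕ) (e : K), (Multiplicative.ofAdd m) • e = e ^ ((p ^ a) ^ m) := by
    intro m e
    change ((powersHom (K →+* K) (iterateFrobenius K p a)) (Multiplicative.ofAdd m)) e = _
    rw [powersHom_apply]
    induction m generalizing e with
    | zero => simp
    | succ m ih =>
      simp only [toAdd_ofAdd] at ih ⊢
      rw [pow_succ, RingHom.mul_def, RingHom.comp_apply, ih, iterateFrobenius_def, ← pow_mul,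
        pow_succ' (p ^ a) m]
  have := SkewMonoidAlgebra.single_mul_single (k := K) (a₁ := Multiplicative.ofAdd m)
    (a₂ := Multiplicative.ofAdd n) (b₁ := c) (b₂ := e)
  rw [h] at this
  exact this

/-- The defining commutation rule of `K[X, σ]`. -/
theorem X_mul_C (c : K) :
    (monomial 1 1 * monomial 0 c : SkewPoly K p a) = monomial 0 (c ^ (p ^ a)) * monomial 1 1 := by
  simp [monomial_mul_monomial]

end SkewPoly

end Skew

/-! ### The universal semi-characteristic polynomial -/

section Universal

variable (K : Type*) [Field K] (q d : ℕ)

/-- The polynomial ring `K[(a_ij), (x_i)]`: `Sum.inl (i, j)` indexes the entry `a_ij` of the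
generic matrix, `Sum.inr i` the coordinate `x_i` of the generic vector. -/
abbrev GenericRing : Type _ := MvPolynomial ((Fin d × Fin d) ⊕ Fin d) K

/-- The iterates of the generic vector `x` under the generic semi-linear map
`v ↦ (a_ij) * (v_j ^ q)_j`. -/
def genericIterate : ℕ → Fin d → GenericRing K d
  | 0 => fun i => MvPolynomial.X (Sum.inr i)
  | n + 1 => fun i => ∑ j, MvPolynomial.X (Sum.inl (i, j)) * genericIterate n j ^ q

/-- The relation `φ^d(x) = P_{d-1} φ^{d-1}(x) + ⋯ + P_1 φ(x) + P_0 x` for the generic `φ`, `x`. -/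
def IsUniversalCoeffs (P : Fin d → GenericRing K d) : Prop :=
  ∀ k : Fin d, genericIterate K q d d k = ∑ i : Fin d, P i * genericIterate K q d i k

open Classical in
/-- The polynomials `P_0, …, P_{d-1}` determined by `IsUniversalCoeffs`. -/
def universalCoeffs : Fin d → GenericRing K d :=
  if h : ∃ P, IsUniversalCoeffs K q d P then h.choose else 0

end Universal

/-! ### `φ`-modules -/

section Modules

variable {K : Type*} [Field K] {p a : ℕ} [Fact p.Prime] [CharP K p]
  {V : Type*} [AddCommGroup V] [Module K V]

/-- The semi-characteristic polynomial `X^d - ∑ P_i(G, ξ) X^i` of `φ` in `x` with respect to a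
basis `b`, where `G` is the matrix of `φ` and `ξ` are the coordinates of `x`. -/
def semiChar {d : ℕ} (b : Module.Basis (Fin d) K V) (φ : V →ₛₗ[iterateFrobenius K p a] V) (x : V) :
    SkewPoly K p a :=
  SkewPoly.monomial d 1 - ∑ i : Fin d, SkewPoly.monomial (i : ℕ)
    (MvPolynomial.eval
      (Sum.elim (fun ij : Fin d × Fin d => b.repr (φ (b ij.2)) ij.1) (fun j => b.repr x j))
      (universalCoeffs K (p ^ a) d i))

/-- `P(φ)(x) = ∑ c_n φ^n(x)` for `P = ∑ c_n X^n`. -/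
def evalAt (φ : V →ₛₗ[iterateFrobenius K p a] V) (P : SkewPoly K p a) (x : V) : V :=
  SkewPolynomial.sum P fun n c => c • φ^[n] x

/-- `N` is a sub-`φ`-module. -/
def IsStable (φ : V →ₛₗ[iterateFrobenius K p a] V) (N : Submodule K V) : Prop :=
  N ≤ N.comap φ

/-- The `φ`-module is generated by `x`: the iterates of `x` span it. -/
def Generates (φ : V →ₛₗ[iterateFrobenius K p a] V) (x : V) : Prop :=
  Submodule.span K (Set.range fun n : ℕ => φ^[n] x) = ⊤

/-- The `φ`-module is simple: it is nonzero and has no nontrivial sub-`φ`-module. -/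
def IsSimplePhi (φ : V →ₛₗ[iterateFrobenius K p a] V) : Prop :=
  Nontrivial V ∧ ∀ N : Submodule K V, IsStable φ N → N = ⊥ ∨ N = ⊤

/-- The map induced by `φ` on a sub-`φ`-module. -/
def restrictPhi (φ : V →ₛₗ[iterateFrobenius K p a] V) (N : Submodule K V) (hN : IsStable φ N) :
    N →ₛₗ[iterateFrobenius K p a] N :=
  LinearMap.codRestrict N (φ.domRestrict N) fun v => hN v.2

theorem isStable_submoduleOf {φ : V →ₛₗ[iterateFrobenius K p a] V} {N N' : Submodule K V}
    (hN : IsStable φ N) (hN' : IsStable φ N') :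
    IsStable (restrictPhi φ N hN) (N'.submoduleOf N) :=
  fun _ hv => hN' hv

/-- The map induced by `φ` on the subquotient `N / (N' ∩ N)` (used with `N' ≤ N`). -/
def subquotientPhi (φ : V →ₛₗ[iterateFrobenius K p a] V) (N N' : Submodule K V)
    (hN : IsStable φ N) (hN' : IsStable φ N') :
    (N ⧸ N'.submoduleOf N) →ₛₗ[iterateFrobenius K p a] (N ⧸ N'.submoduleOf N) :=
  Submodule.mapQ (N'.submoduleOf N) (N'.submoduleOf N) (restrictPhi φ N hN)
    (isStable_submoduleOf hN hN')

/-- A Jordan–Hölder sequence `0 = D_m ⊂ ⋯ ⊂ D_0 = V` of the `φ`-module `V`. -/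
structure JHSeq (φ : V →ₛₗ[iterateFrobenius K p a] V) (m : ℕ) where
  /-- the terms of the sequence -/
  D : Fin (m + 1) → Submodule K V
  stable : ∀ i, IsStable φ (D i)
  top : D 0 = ⊤
  bot : D (Fin.last m) = ⊥
  le : ∀ i : Fin m, D i.succ ≤ D i.castSucc
  simple : ∀ i : Fin m, IsSimplePhi
    (subquotientPhi φ (D i.castSucc) (D i.succ) (stable i.castSucc) (stable i.succ))

/-- The ordered product `π_{m-1} ⋯ π_1 π_0`. -/
def descProd {m : ℕ} (π : Fin m → SkewPoly K p a) : SkewPoly K p a :=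
  (List.ofFn π).reverse.prod

/-- The ordered product `π_{i-1} ⋯ π_1 π_0`. -/
def partialDescProd {m : ℕ} (π : Fin m → SkewPoly K p a) (i : Fin m) : SkewPoly K p a :=
  ((List.ofFn π).take i).reverse.prod

namespace JHSeq

variable {φ : V →ₛₗ[iterateFrobenius K p a] V} {m : ℕ}

/-- The composition factor `D_i / D_{i+1}`. -/
abbrev Factor (S : JHSeq φ m) (i : Fin m) : Type _ :=
  S.D i.castSucc ⧸ (S.D i.succ).submoduleOf (S.D i.castSucc)

/-- The map induced by `φ` on `D_i / D_{i+1}`. -/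
def factorPhi (S : JHSeq φ m) (i : Fin m) : S.Factor i →ₛₗ[iterateFrobenius K p a] S.Factor i :=
  subquotientPhi φ (S.D i.castSucc) (S.D i.succ) (S.stable i.castSucc) (S.stable i.succ)

/-- `π_i` is the semi-characteristic polynomial of `D_i / D_{i+1}` in `y_i` (in any basis), and
`y_i` is the class of `(π_{i-1} ⋯ π_0)(φ)(x)`, which lies in `D_i`. -/
def IsFactorData (S : JHSeq φ m) (x : V) (y : ∀ i : Fin m, S.Factor i)
    (π : Fin m → SkewPoly K p a) : Prop :=
  ∀ i : Fin m,
    (∃ w : S.D i.castSucc, (w : V) = evalAt φ (partialDescProd π i) x ∧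
      y i = Submodule.Quotient.mk w) ∧
    ∀ (e : ℕ) (c : Module.Basis (Fin e) K (S.Factor i)), π i = semiChar c (S.factorPhi i) (y i)

end JHSeq

/-- The factorizations `P = π_{m-1} ⋯ π_0` into `m` monic irreducible skew polynomials. -/
def Factorization (P : SkewPoly K p a) (m : ℕ) : Type _ :=
  {π : Fin m → SkewPoly K p a // (∀ i, (π i).Monic ∧ Irreducible (π i)) ∧ P = descProd π}

end Modules

end PhiModule

end

noncomputable section

namespace PhiModule

/-! Skew polynomials are modelled as ordinary polynomials with the product `skewMul`, over any
commutative ring of characteristic p, acting on modules through a semilinear map (`act`). One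
principle carries most of the proof: over a domain, if the first d iterates of a vector of rank d
are independent, at most one monic polynomial of degree d kills it. Identities between
semi-characteristic polynomials are proved for generic data, where this applies, and then
specialized to K.

Existence of the P_i: specializing to the shift shows that the generic iterates have nonzero
determinant, so the P_i exist over the fraction field of the polynomial ring R. Let Q be the
resulting monic polynomial. As R^d is noetherian, some monic P over R also kills the generic vector,
and division shows that Q is a right factor of P. Replacing X^n by X^(q^n) turns products into
compositions, and right factors into ordinary divisors of monic polynomials; R being integrally
closed, Q has coefficients in R (`coeff_mem_range_of_act_eq_zero`).

The principle also gives independence of the basis (`chi_conj`) and multiplicativity (`chi_block`,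
`modChar_of_exact`): the polynomial of D in x is that of D' in y times that of D/D' in the class of
x, where y is the value at x of the second factor. Iterating along a Jordan–Hölder sequence gives
the product in (1).

In a simple module every nonzero vector generates, so no nonzero polynomial of degree below the
dimension kills it; a proper factorization SR of the semi-characteristic polynomial in y would make
S(φ)(R(φ)(y)) nonzero, although it vanishes. Conversely, a proper nonzero stable subspace yields a
proper factorization, so irreducibility forces simplicity.

When x generates D, the vector (π_{i-1}⋯π_0)(φ)(x) generates D_i, so the factors determine the
sequence. Given a factorization, these vectors define the D_i; each quotient has a generator killed
by its factor, hence dimension at most its degree, and since the degrees add up to dim D all these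
inequalities are equalities. -/

open Polynomial in
/-- The skew product of two polynomials over a commutative ring of characteristic `p`, for the
rule `X * c = c ^ (p ^ a) * X`. -/
def skewMul {A : Type*} [CommRing A] (p a : ℕ) [Fact p.Prime] [CharP A p] (s r : A[X]) : A[X] :=
  s.sum fun i c => monomial i c * r.map (iterateFrobenius A p (a * i))

/-- The action `∑ c_n X^n ↦ ∑ c_n Φ^n(x)` of polynomials through a semilinear map. -/
def act {A : Type*} [CommRing A] {p a : ℕ} [Fact p.Prime] [CharP A p] {M : Type*}
    [AddCommGroup M] [Module A M] (Φ : M →ₛₗ[iterateFrobenius A p a] M) (P : Polynomial A)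
    (x : M) : M :=
  P.sum fun n c => c • Φ^[n] x

/-! ### Skew multiplication on ordinary polynomials -/

section SkewMul

open Polynomial

variable {A : Type*} [CommRing A] {p a : ℕ} [Fact p.Prime] [CharP A p]

theorem skewMul_add_left (s t r : A[X]) :
    skewMul p a (s + t) r = skewMul p a s r + skewMul p a t r :=
  sum_add_index s t _ (by simp) (by simp [add_mul])

theorem skewMul_add_right (s r t : A[X]) :
    skewMul p a s (r + t) = skewMul p a s r + skewMul p a s t := by
  simp [skewMul, Polynomial.sum_def, mul_add, Finset.sum_add_distrib]

theorem skewMul_monomial_left (n : ℕ) (c : A) (r : A[X]) :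
    skewMul p a (monomial n c) r = monomial n c * r.map (iterateFrobenius A p (a * n)) :=
  sum_monomial_index _ _ (by simp)

theorem skewMul_monomial_monomial (m n : ℕ) (c e : A) :
    skewMul p a (monomial m c) (monomial n e) =
      monomial (m + n) (c * iterateFrobenius A p (a * m) e) := by
  rw [skewMul_monomial_left, map_monomial, monomial_mul_monomial]

theorem coeff_skewMul (s r : A[X]) (k : ℕ) :
    (skewMul p a s r).coeff k = ∑ ij ∈ Finset.HasAntidiagonal.antidiagonal k,
      s.coeff ij.1 * iterateFrobenius A p (a * ij.1) (r.coeff ij.2) := by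
  induction s using Polynomial.induction_on' with
  | add s t hs ht => simp [skewMul_add_left, hs, ht, add_mul, Finset.sum_add_distrib]
  | monomial m c =>
    induction r using Polynomial.induction_on' with
    | add s t hs ht => simp [skewMul_add_right, hs, ht, mul_add, Finset.sum_add_distrib]
    | monomial n e =>
      rw [skewMul_monomial_monomial, coeff_monomial]
      split_ifs with h
      · rw [Finset.sum_eq_single (m, n)]
        · simp
        · rintro ⟨i, j⟩ _ hne
          simp only [coeff_monomial]
          by_cases hi : m = i
          · by_cases hj : n = j
            · exact absurd (by rw [hi, hj]) hne
            · simp [hj]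
          · simp [hi]
        · intro hn
          exact absurd (Finset.HasAntidiagonal.mem_antidiagonal.2 h) hn
      · refine (Finset.sum_eq_zero ?_).symm
        rintro ⟨i, j⟩ hij
        simp only [coeff_monomial]
        by_cases hi : m = i
        · by_cases hj : n = j
          · exact absurd (by rw [hi, hj]; exact Finset.HasAntidiagonal.mem_antidiagonal.1 hij) h
          · simp [hj]
        · simp [hi]

theorem coeff_skewMul_of_lt {s r : A[X]} {m n k : ℕ} (hs : s.natDegree ≤ m) (hr : r.natDegree ≤ n)
    (hk : m + n < k) : (skewMul p a s r).coeff k = 0 := by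
  rw [coeff_skewMul]
  refine Finset.sum_eq_zero ?_
  rintro ⟨i, j⟩ hij
  have h := Finset.HasAntidiagonal.mem_antidiagonal.1 hij
  simp only at h ⊢
  by_cases hi : m < i
  · rw [coeff_eq_zero_of_natDegree_lt (lt_of_le_of_lt hs hi), zero_mul]
  · rw [coeff_eq_zero_of_natDegree_lt (p := r) (by omega), map_zero, mul_zero]

theorem coeff_skewMul_add {s r : A[X]} {m n : ℕ} (hs : s.natDegree ≤ m) (hr : r.natDegree ≤ n) :
    (skewMul p a s r).coeff (m + n) =
      s.coeff m * iterateFrobenius A p (a * m) (r.coeff n) := by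
  rw [coeff_skewMul, Finset.sum_eq_single (m, n)]
  · rintro ⟨i, j⟩ hij hne
    have h := Finset.HasAntidiagonal.mem_antidiagonal.1 hij
    simp only at h ⊢
    by_cases hi : m < i
    · rw [coeff_eq_zero_of_natDegree_lt (lt_of_le_of_lt hs hi), zero_mul]
    · have : m ≠ i := by
        rintro rfl
        exact hne (by rw [add_left_cancel h])
      rw [coeff_eq_zero_of_natDegree_lt (p := r) (by omega), map_zero, mul_zero]
  · intro h
    exact absurd (Finset.HasAntidiagonal.mem_antidiagonal.2 (rfl : m + n = m + n)) h

theorem natDegree_skewMul_le (s r : A[X]) :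
    (skewMul p a s r).natDegree ≤ s.natDegree + r.natDegree :=
  natDegree_le_iff_coeff_eq_zero.2 fun _ hk => coeff_skewMul_of_lt le_rfl le_rfl hk

theorem map_skewMul {B : Type*} [CommRing B] [CharP B p] (g : A →+* B) (s r : A[X]) :
    (skewMul p a s r).map g = skewMul p a (s.map g) (r.map g) := by
  ext k
  simp [coeff_skewMul, iterateFrobenius_def]

end SkewMul

/-! ### Action of skew polynomials through a semilinear map -/

section Act

open Polynomial

variable {A : Type*} [CommRing A] {p a : ℕ} [Fact p.Prime] [CharP A p]
  {M : Type*} [AddCommGroup M] [Module A M] (Φ : M →ₛₗ[iterateFrobenius A p a] M)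

theorem act_add (s t : A[X]) (x : M) : act Φ (s + t) x = act Φ s x + act Φ t x :=
  sum_add_index s t _ (by simp) (by simp [add_smul])

theorem act_monomial (n : ℕ) (c : A) (x : M) : act Φ (monomial n c) x = c • Φ^[n] x :=
  sum_monomial_index _ _ (by simp)

theorem act_zero (x : M) : act Φ (0 : A[X]) x = 0 := by simp [act]

/-- `act` as an additive map in the polynomial. -/
def actHom (x : M) : A[X] →+ M where
  toFun P := act Φ P x
  map_zero' := act_zero Φ x
  map_add' s t := act_add Φ s t x

theorem iterate_map_smul' (n : ℕ) (c : A) (x : M) :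
    Φ^[n] (c • x) = iterateFrobenius A p (a * n) c • Φ^[n] x := by
  induction n with
  | zero => simp
  | succ n ih =>
    rw [Function.iterate_succ_apply', ih, map_smulₛₗ, Function.iterate_succ_apply']
    simp only [iterateFrobenius_def, ← pow_mul, ← pow_add]
    ring_nf

theorem act_zero_right (P : A[X]) : act Φ P 0 = 0 := by
  simp [act, Polynomial.sum_def]

theorem act_skewMul (s r : A[X]) (x : M) : act Φ (skewMul p a s r) x = act Φ s (act Φ r x) := by
  induction s using Polynomial.induction_on' with
  | add s t hs ht => simp [skewMul_add_left, act_add, hs, ht]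
  | monomial m c =>
    induction r using Polynomial.induction_on' with
    | add s t hs ht =>
      rw [skewMul_add_right, act_add, act_add, hs, ht]
      simp [act_monomial, iterate_map_add]
    | monomial n e =>
      rw [skewMul_monomial_monomial, act_monomial, act_monomial, act_monomial,
        iterate_map_smul', smul_smul, Function.iterate_add_apply]

/-- Stated for f semilinear along a ring homomorphism g, so that the same lemma serves for
specializing coefficients and, with g the identity, for morphisms of `φ`-modules. -/
theorem map_act {B : Type*} [CommRing B] [CharP B p] {N : Type*} [AddCommGroup N] [Module B N]
    {Φ : M →ₛₗ[iterateFrobenius A p a] M} {Ψ : N →ₛₗ[iterateFrobenius B p a] N} {g : A →+* B}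
    (f : M →ₛₗ[g] N) (h : ∀ x, f (Φ x) = Ψ (f x)) (P : A[X]) (x : M) :
    f (act Φ P x) = act Ψ (P.map g) (f x) := by
  have hn : ∀ n x, f (Φ^[n] x) = Ψ^[n] (f x) := by
    intro n x
    induction n with
    | zero => rfl
    | succ n ih => rw [Function.iterate_succ_apply', h, ih, Function.iterate_succ_apply']
  induction P using Polynomial.induction_on' with
  | add s t hs ht => simp [act_add, hs, ht]
  | monomial n c => simp [act_monomial, hn]

theorem map_act_linear {N : Type*} [AddCommGroup N] [Module A N]
    {Φ : M →ₛₗ[iterateFrobenius A p a] M} {Ψ : N →ₛₗ[iterateFrobenius A p a] N}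
    (f : M →ₗ[A] N) (h : ∀ x, f (Φ x) = Ψ (f x)) (P : A[X]) (x : M) :
    f (act Φ P x) = act Ψ P (f x) := by
  simpa using map_act f h P x

end Act

/-! ### Right division and monic annihilators -/

section Division

open Polynomial

variable {A : Type*} [CommRing A] {p a : ℕ} [Fact p.Prime] [CharP A p]

theorem monic_skewMul {s r : A[X]} (hs : s.Monic) (hr : r.Monic) :
    (skewMul p a s r).Monic :=
  monic_of_natDegree_le_of_coeff_eq_one _ (natDegree_skewMul_le s r) (by
    rw [coeff_skewMul_add le_rfl le_rfl, hs.coeff_natDegree, hr.coeff_natDegree]; simp)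

theorem natDegree_skewMul_of_monic [Nontrivial A] {s r : A[X]} (hs : s.Monic) (hr : r.Monic) :
    (skewMul p a s r).natDegree = s.natDegree + r.natDegree :=
  le_antisymm (natDegree_skewMul_le s r) (le_natDegree_of_ne_zero (by
    rw [coeff_skewMul_add le_rfl le_rfl, hs.coeff_natDegree, hr.coeff_natDegree]; simp))

/-- Right division with remainder by a monic skew polynomial. -/
theorem exists_eq_skewMul_add (p a : ℕ) [Fact p.Prime] [CharP A p] {Q : A[X]} (hQ : Q.Monic)
    (P : A[X]) :
    ∃ S R : A[X], P = skewMul p a S Q + R ∧ R.degree < Q.natDegree := by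
  suffices h : ∀ (n : ℕ) (P : A[X]), P.degree < n →
      ∃ S R : A[X], P = skewMul p a S Q + R ∧ R.degree < Q.natDegree from
    h (P.natDegree + 1) P (lt_of_le_of_lt degree_le_natDegree (by exact_mod_cast Nat.lt_succ_self _))
  intro n
  induction n with
  | zero =>
    intro P hP
    refine ⟨0, P, by simp [skewMul], lt_of_lt_of_le hP ?_⟩
    exact_mod_cast Nat.zero_le _
  | succ n ih =>
    intro P hP
    rcases lt_or_ge n Q.natDegree with h | h
    · refine ⟨0, P, by simp [skewMul], lt_of_lt_of_le hP ?_⟩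
      exact_mod_cast h
    · set T : A[X] := monomial (n - Q.natDegree) (P.coeff n) with hT
      have hTd : T.natDegree ≤ n - Q.natDegree := natDegree_monomial_le _
      obtain ⟨S, R, hSR, hR⟩ := ih (P - skewMul p a T Q) (by
        rw [degree_lt_iff_coeff_zero]
        intro m hm
        rcases hm.eq_or_lt with rfl | hm
        -- The twist acts only on the leading coefficient 1 of `Q`, so the top coefficient of the
        -- product is `P.coeff n`, with nothing to invert.
        · have := coeff_skewMul_add (p := p) (a := a) hTd (le_refl Q.natDegree)
          rw [Nat.sub_add_cancel h] at this
          rw [coeff_sub, this, hQ.coeff_natDegree, hT, coeff_monomial_same]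
          simp
        · rw [coeff_sub, coeff_skewMul_of_lt hTd le_rfl (by omega), sub_zero]
          exact (degree_lt_iff_coeff_zero _ _).1 hP m (by omega))
      refine ⟨T + S, R, ?_, hR⟩
      rw [skewMul_add_left, add_assoc, ← hSR]
      ring

/-- The spans of the first n iterates form an increasing chain, which stabilizes; some iterate is
then a combination of the earlier ones. The degree is not controlled: this only supplies the
integrality needed to descend from the fraction field. -/
theorem exists_monic_act_eq_zero {M : Type*} [AddCommGroup M] [Module A M] [IsNoetherian A M]
    (Φ : M →ₛₗ[iterateFrobenius A p a] M) (x : M) : ∃ P : A[X], P.Monic ∧ act Φ P x = 0 := by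
  let N : ℕ →o Submodule A M :=
    ⟨fun n => Submodule.span A ((fun i => Φ^[i] x) '' (Finset.range n : Set ℕ)), fun m n h =>
      Submodule.span_mono (Set.image_mono (by exact_mod_cast Finset.range_mono h))⟩
  obtain ⟨n, hn⟩ := monotone_stabilizes_iff_noetherian.2 ‹IsNoetherian A M› N
  have hmem : Φ^[n] x ∈ N n := by
    rw [hn (n + 1) (Nat.le_succ n)]
    exact Submodule.subset_span ⟨n, by simp, rfl⟩
  obtain ⟨e, he⟩ := (Submodule.mem_span_image_finset_iff_exists_fun A).1 hmem
  let T : A[X] := ∑ i : Finset.range n, monomial (i : ℕ) (e i)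
  have hT : T.degree < n := by
    refine lt_of_le_of_lt (degree_sum_le _ _) ((Finset.sup_lt_iff (WithBot.bot_lt_coe n)).2 ?_)
    intro i _
    exact lt_of_le_of_lt (degree_monomial_le _ _) (WithBot.coe_lt_coe.2 (Finset.mem_range.1 i.2))
  refine ⟨X ^ n - T, monic_X_pow_sub hT, ?_⟩
  have hTx : act Φ T x = Φ^[n] x := by
    rw [← he]
    change actHom Φ x T = _
    rw [map_sum]
    exact Finset.sum_congr rfl fun i _ => act_monomial Φ i (e i) x
  have := act_add Φ (X ^ n - T) T x
  rw [sub_add_cancel, hTx, ← monomial_one_right_eq_X_pow, act_monomial, one_smul] at this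
  rw [← monomial_one_right_eq_X_pow]
  simpa using this

end Division

/-! ### Linearized polynomials -/

section Linearized

open Polynomial

variable (A : Type*) [CommRing A] (p a : ℕ) [Fact p.Prime] [CharP A p]

/-- The `p ^ a`-power map on `A[X]`. -/
def polyFrob : A[X] →ₛₗ[iterateFrobenius A p a] A[X] where
  toFun g := g ^ p ^ a
  map_add' g h := by simpa [iterateFrobenius_def] using map_add (iterateFrobenius A[X] p a) g h
  map_smul' c g := by rw [_root_.smul_pow, iterateFrobenius_def]

variable {A p a}

theorem polyFrob_iterate (n : ℕ) (g : A[X]) : (polyFrob A p a)^[n] g = g ^ (p ^ a) ^ n := by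
  induction n with
  | zero => simp
  | succ n ih =>
    rw [Function.iterate_succ_apply', ih]
    change (g ^ (p ^ a) ^ n) ^ p ^ a = _
    rw [← pow_mul, pow_succ]

/-- Every term c g^(q^n) is a multiple of g. Combined with `act_skewMul`, this turns a right factor
of a skew polynomial into an ordinary divisor of its linearized polynomial. -/
theorem dvd_act_polyFrob (P g : A[X]) : g ∣ act (polyFrob A p a) P g := by
  refine Finset.dvd_sum fun n _ => ?_
  simp only [polyFrob_iterate, smul_eq_C_mul]
  exact Dvd.dvd.mul_left (dvd_pow_self g (pow_ne_zero _ (pow_ne_zero _ (Fact.out : p.Prime).ne_zero))) _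

/-- Here a ≥ 1 matters: it gives q > 1, so the exponents q^n are distinct and no two coefficients
merge. -/
theorem coeff_act_polyFrob (ha : 1 ≤ a) (P : A[X]) (n : ℕ) :
    (act (polyFrob A p a) P X).coeff ((p ^ a) ^ n) = P.coeff n := by
  have hq : 1 < p ^ a := Nat.one_lt_pow (by omega) (Fact.out : p.Prime).one_lt
  induction P using Polynomial.induction_on' with
  | add s t hs ht => simp [act_add, hs, ht]
  | monomial m c =>
    rw [act_monomial, polyFrob_iterate, coeff_smul, coeff_X_pow, coeff_monomial]
    simp [Nat.pow_right_inj hq, eq_comm]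

theorem natDegree_act_polyFrob_le (P : A[X]) :
    (act (polyFrob A p a) P X).natDegree ≤ (p ^ a) ^ P.natDegree := by
  refine natDegree_sum_le_of_forall_le _ _ fun n hn => ?_
  simp only [polyFrob_iterate]
  refine (natDegree_smul_le _ _).trans ((natDegree_X_pow_le _).trans ?_)
  exact Nat.pow_le_pow_right (pow_pos (Fact.out : p.Prime).pos a) (le_natDegree_of_mem_supp n hn)

theorem monic_act_polyFrob (ha : 1 ≤ a) {P : A[X]} (hP : P.Monic) :
    (act (polyFrob A p a) P X).Monic :=
  monic_of_natDegree_le_of_coeff_eq_one _ (natDegree_act_polyFrob_le P)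
    (by rw [coeff_act_polyFrob ha, hP.coeff_natDegree])

theorem map_act_polyFrob {B : Type*} [CommRing B] [CharP B p] (g : A →+* B) (P : A[X]) :
    (act (polyFrob A p a) P X).map g = act (polyFrob B p a) (P.map g) X := by
  induction P using Polynomial.induction_on' with
  | add s t hs ht => simp [act_add, hs, ht]
  | monomial m c => simp [act_monomial, polyFrob_iterate, smul_eq_C_mul]

end Linearized

/-! ### Descent from the fraction field to an integrally closed domain -/

section IntegrallyClosed

open Polynomial

/-- If `x` is independent of its iterates up to degree `d` over the fraction field, and a monic
skew polynomial over an integrally closed domain kills it, then a monic skew polynomial of degree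
`d` over the fraction field which kills it has coefficients in the domain. -/
theorem coeff_mem_range_of_act_eq_zero {R F : Type*} [CommRing R] [IsDomain R]
    [IsIntegrallyClosed R] [Field F] [Algebra R F] [IsFractionRing R F] {p a : ℕ} [Fact p.Prime]
    [CharP R p] [CharP F p] (ha : 1 ≤ a) {M : Type*} [AddCommGroup M] [Module F M]
    (Φ : M →ₛₗ[iterateFrobenius F p a] M) (x : M) {Q : F[X]} (hQ : Q.Monic)
    (hQx : act Φ Q x = 0)
    (hind : ∀ T : F[X], T.degree < Q.natDegree → act Φ T x = 0 → T = 0)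
    {P : R[X]} (hP : P.Monic) (hPx : act Φ (P.map (algebraMap R F)) x = 0) (n : ℕ) :
    Q.coeff n ∈ Set.range (algebraMap R F) := by
  obtain ⟨S, T, hST, hT⟩ := exists_eq_skewMul_add p a hQ (P.map (algebraMap R F))
  have hT0 : T = 0 := hind T hT (by
    rw [hST, act_add, act_skewMul, hQx, act_zero_right, zero_add] at hPx
    exact hPx)
  rw [hT0, add_zero] at hST
  -- With P = S·Q in the skew sense, the linearized polynomial of P is S acting on that of Q, hence
  -- a multiple of it.
  have hdvd : act (polyFrob F p a) Q X ∣
      (act (polyFrob R p a) P X).map (algebraMap R F) := by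
    rw [map_act_polyFrob, hST, act_skewMul]
    exact dvd_act_polyFrob _ _
  have := integralClosure.mem_lifts_of_monic_of_dvd_map F (monic_act_polyFrob ha hP)
    (monic_act_polyFrob ha hQ) hdvd
  rw [lifts_iff_coeff_lifts] at this
  obtain ⟨c, hc⟩ := this ((p ^ a) ^ n)
  rw [coeff_act_polyFrob ha] at hc
  exact IsIntegrallyClosed.isIntegral_iff.1 (hc ▸ c.2)

end IntegrallyClosed

/-! ### Semilinear maps given by matrices -/

section MatPhi

variable {A : Type*} [CommRing A] {ι : Type*} [Fintype ι]

/-- The semilinear map of `ι → A` with matrix `G`. -/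
def matPhi (p a : ℕ) [Fact p.Prime] [CharP A p] (G : Matrix ι ι A) :
    (ι → A) →ₛₗ[iterateFrobenius A p a] (ι → A) where
  toFun w i := ∑ j, G i j * w j ^ p ^ a
  map_add' v w := by
    ext i
    have h : ∀ x y : A, (x + y) ^ p ^ a = x ^ p ^ a + y ^ p ^ a := fun x y => by
      simpa [iterateFrobenius_def] using map_add (iterateFrobenius A p a) x y
    simp [h, mul_add, Finset.sum_add_distrib]
  map_smul' c w := by
    ext i
    simp [mul_pow, Finset.mul_sum, iterateFrobenius_def, mul_left_comm]

variable {p a : ℕ} [Fact p.Prime] [CharP A p]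

theorem matPhi_apply (G : Matrix ι ι A) (w : ι → A) (i : ι) :
    matPhi p a G w i = ∑ j, G i j * w j ^ p ^ a := rfl

/-- Applying a ring homomorphism to coordinates. -/
def mapVec {B : Type*} [CommRing B] (ι : Type*) (g : A →+* B) : (ι → A) →ₛₗ[g] (ι → B) where
  toFun w i := g (w i)
  map_add' v w := by ext; simp
  map_smul' c w := by ext; simp

omit [Fintype ι] in
theorem mapVec_apply {B : Type*} [CommRing B] (g : A →+* B) (w : ι → A) (i : ι) :
    mapVec ι g w i = g (w i) := rfl

theorem mapVec_mulVec {B : Type*} [CommRing B] (g : A →+* B) (C : Matrix ι ι A) (w : ι → A) :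
    mapVec ι g (C.mulVec w) = (C.map g).mulVec (mapVec ι g w) := by
  ext i
  simp [mapVec_apply, Matrix.mulVec, dotProduct]

theorem mapVec_matPhi {B : Type*} [CommRing B] [CharP B p] (g : A →+* B) (G : Matrix ι ι A)
    (w : ι → A) : mapVec ι g (matPhi p a G w) = matPhi p a (G.map g) (mapVec ι g w) := by
  ext i
  simp [mapVec, matPhi_apply]

/-- The matrix whose rows are the first iterates of `x`. -/
def iterMat {d : ℕ} (Φ : (Fin d → A) → (Fin d → A)) (x : Fin d → A) : Matrix (Fin d) (Fin d) A :=
  Matrix.of fun i => Φ^[(i : ℕ)] x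

theorem iterMat_map {B : Type*} [CommRing B] [CharP B p] {d : ℕ} (g : A →+* B)
    (G : Matrix (Fin d) (Fin d) A) (w : Fin d → A) :
    (iterMat (matPhi p a G) w).map g = iterMat (matPhi p a (G.map g)) (mapVec _ g w) := by
  have h : ∀ n : ℕ, mapVec _ g ((matPhi p a G)^[n] w) = (matPhi p a (G.map g))^[n] (mapVec _ g w) := by
    intro n
    induction n with
    | zero => rfl
    | succ n ih => rw [Function.iterate_succ_apply', mapVec_matPhi, ih, Function.iterate_succ_apply']
  ext i k
  exact congrFun (h i) k

open Polynomial in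
theorem act_eq_sum_fin {M : Type*} [AddCommGroup M] [Module A M]
    (Φ : M →ₛₗ[iterateFrobenius A p a] M) {d : ℕ} {T : A[X]} (hT : T.degree < d) (x : M) :
    act Φ T x = ∑ i : Fin d, T.coeff i • Φ^[(i : ℕ)] x := by
  rw [Fin.sum_univ_eq_sum_range (fun i => T.coeff i • Φ^[i] x)]
  refine Polynomial.sum_eq_of_subset _ (by simp) fun i hi => ?_
  rw [Finset.mem_range]
  exact_mod_cast lt_of_le_of_lt (Polynomial.le_degree_of_mem_supp _ hi) hT

open Polynomial in
theorem eq_zero_of_act_eq_zero [IsDomain A] {d : ℕ}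
    (Φ : (Fin d → A) →ₛₗ[iterateFrobenius A p a] (Fin d → A)) {x : Fin d → A}
    (hx : (iterMat Φ x).det ≠ 0) {T : A[X]} (hT : T.degree < d) (h : act Φ T x = 0) : T = 0 := by
  have := Matrix.eq_zero_of_vecMul_eq_zero hx (v := fun i : Fin d => T.coeff i) (by
    rw [act_eq_sum_fin Φ hT] at h
    ext k
    have := congrFun h k
    simpa [Matrix.vecMul, dotProduct, iterMat] using this)
  ext n
  rcases lt_or_ge n d with hn | hn
  · exact congrFun this ⟨n, hn⟩
  · exact (degree_lt_iff_coeff_zero _ _).1 hT n hn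

-- The difference has degree below d and kills x, so its coefficients form a vector in the left
-- kernel of the matrix of iterates. A domain suffices; no inverse matrix is needed.
open Polynomial in
theorem eq_of_act_eq_zero [IsDomain A] {d : ℕ}
    (Φ : (Fin d → A) →ₛₗ[iterateFrobenius A p a] (Fin d → A)) {x : Fin d → A}
    (hx : (iterMat Φ x).det ≠ 0) {P Q : A[X]} (hP : P.Monic) (hPd : P.natDegree = d)
    (hQ : Q.Monic) (hQd : Q.natDegree = d) (hPx : act Φ P x = 0) (hQx : act Φ Q x = 0) :
    P = Q := by
  rw [← sub_eq_zero]
  refine eq_zero_of_act_eq_zero Φ hx ?_ ?_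
  · rw [← hPd, ← degree_eq_natDegree hP.ne_zero]
    refine degree_sub_lt_left ?_ hP.ne_zero (by rw [hP.leadingCoeff, hQ.leadingCoeff])
    rw [degree_eq_natDegree hP.ne_zero, degree_eq_natDegree hQ.ne_zero, hPd, hQd]
  · have := map_sub (actHom Φ x) P Q
    change act Φ (P - Q) x = act Φ P x - act Φ Q x at this
    rw [this, hPx, hQx, sub_zero]

end MatPhi

/-! ### The monic polynomial of a coefficient family -/

section CharOf

open Polynomial

variable {A : Type*} [CommRing A] {d : ℕ}

/-- The monic polynomial `X^d - ∑ P_i X^i`. -/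
def charOf (P : Fin d → A) : A[X] := X ^ d - ∑ i : Fin d, monomial (i : ℕ) (P i)

theorem degree_sum_monomial_lt (P : Fin d → A) :
    (∑ i : Fin d, monomial (i : ℕ) (P i)).degree < d := by
  refine lt_of_le_of_lt (degree_sum_le _ _) ((Finset.sup_lt_iff (WithBot.bot_lt_coe d)).2 ?_)
  exact fun i _ => lt_of_le_of_lt (degree_monomial_le _ _) (WithBot.coe_lt_coe.2 i.2)

theorem monic_charOf (P : Fin d → A) : (charOf P).Monic :=
  monic_X_pow_sub (degree_sum_monomial_lt P)

theorem natDegree_charOf [Nontrivial A] (P : Fin d → A) : (charOf P).natDegree = d := by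
  refine natDegree_eq_of_degree_eq_some ?_
  rw [charOf, degree_sub_eq_left_of_degree_lt] <;> rw [degree_X_pow]
  exact degree_sum_monomial_lt P

theorem coeff_charOf (P : Fin d → A) (i : Fin d) : (charOf P).coeff i = - P i := by
  simp [charOf, coeff_X_pow, i.2.ne, coeff_monomial, Fin.val_inj]

theorem charOf_injective : Function.Injective (charOf : (Fin d → A) → A[X]) := by
  intro P Q h
  ext i
  have := congrArg (fun T => T.coeff i) h
  simpa [coeff_charOf] using this

theorem map_charOf {B : Type*} [CommRing B] (g : A →+* B) (P : Fin d → A) :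
    (charOf P).map g = charOf (fun i => g (P i)) := by
  simp [charOf, Polynomial.map_sum]

theorem act_charOf {p a : ℕ} [Fact p.Prime] [CharP A p] {M : Type*} [AddCommGroup M] [Module A M]
    (Φ : M →ₛₗ[iterateFrobenius A p a] M) (P : Fin d → A) (x : M) :
    act Φ (charOf P) x = Φ^[d] x - ∑ i : Fin d, P i • Φ^[(i : ℕ)] x := by
  change actHom Φ x (charOf P) = _
  rw [charOf, map_sub, map_sum, ← monomial_one_right_eq_X_pow]
  simp [actHom, act_monomial]

end CharOf

/-! ### Existence and uniqueness of the universal coefficients -/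

section Generic

variable (K : Type*) [Field K] (p a d : ℕ) [Fact p.Prime] [CharP K p]

/-- The generic matrix. -/
def genericMat : Matrix (Fin d) (Fin d) (GenericRing K d) :=
  Matrix.of fun i j => MvPolynomial.X (Sum.inl (i, j))

/-- The generic vector. -/
def genericVec : Fin d → GenericRing K d := fun i => MvPolynomial.X (Sum.inr i)

theorem genericIterate_eq (n : ℕ) :
    genericIterate K (p ^ a) d n = (matPhi p a (genericMat K d))^[n] (genericVec K d) := by
  induction n with
  | zero => rfl
  | succ n ih =>
    rw [Function.iterate_succ_apply', ← ih]
    rfl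

theorem isUniversalCoeffs_iff (P : Fin d → GenericRing K d) :
    IsUniversalCoeffs K (p ^ a) d P ↔
      act (matPhi p a (genericMat K d)) (charOf P) (genericVec K d) = 0 := by
  rw [act_charOf, sub_eq_zero, funext_iff, IsUniversalCoeffs]
  refine forall_congr' fun k => ?_
  simp [genericIterate_eq K p a d, Finset.sum_apply]

variable {d}

/-- Specialization of the generic matrix and vector. -/
def specialize {A : Type*} [CommRing A] [Algebra K A] (G : Matrix (Fin d) (Fin d) A)
    (ξ : Fin d → A) : GenericRing K d →ₐ[K] A :=
  MvPolynomial.aeval (Sum.elim (fun ij : Fin d × Fin d => G ij.1 ij.2) ξ)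

theorem genericMat_map {A : Type*} [CommRing A] [Algebra K A] (G : Matrix (Fin d) (Fin d) A)
    (ξ : Fin d → A) : (genericMat K d).map (specialize K G ξ) = G := by
  ext i j
  simp [genericMat, specialize]

theorem mapVec_genericVec {A : Type*} [CommRing A] [Algebra K A] (G : Matrix (Fin d) (Fin d) A)
    (ξ : Fin d → A) :
    mapVec (Fin d) (specialize K G ξ : GenericRing K d →+* A) (genericVec K d) = ξ := by
  ext i
  rw [mapVec_apply]
  simp [genericVec, specialize]

variable (A : Type*) [CommRing A]

/-- The matrix of the shift `e_j ↦ e_{j+1}`. -/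
def shiftMat (d : ℕ) : Matrix (Fin d) (Fin d) A :=
  Matrix.of fun i j => if (i : ℕ) = j + 1 then 1 else 0

/-- The first basis vector. -/
def shiftVec (d : ℕ) : Fin d → A := fun i => if (i : ℕ) = 0 then 1 else 0

variable {K A}

theorem shift_iterate [CharP A p] (d n : ℕ) :
    (matPhi p a (shiftMat A d))^[n] (shiftVec A d) = fun i : Fin d => if (i : ℕ) = n then 1 else 0 := by
  have hq : p ^ a ≠ 0 := pow_ne_zero _ (Fact.out : p.Prime).ne_zero
  induction n with
  | zero => rfl
  | succ n ih =>
    rw [Function.iterate_succ_apply', ih]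
    ext i
    rw [matPhi_apply]
    simp only [shiftMat, Matrix.of_apply, ite_pow, one_pow, zero_pow hq, mul_ite, mul_one, mul_zero]
    split_ifs with h
    · rw [Finset.sum_eq_single ⟨n, by omega⟩]
      · simp [h]
      · rintro ⟨j, hj⟩ _ hne
        rw [if_neg]
        rintro rfl
        exact hne rfl
      · simp
    · refine Finset.sum_eq_zero fun j _ => ?_
      split_ifs with h1 h2
      · omega
      · rfl
      · rfl

theorem iterMat_shift [CharP A p] (d : ℕ) :
    iterMat (matPhi p a (shiftMat A d)) (shiftVec A d) = 1 := by
  ext i k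
  simp [iterMat, shift_iterate, Matrix.one_apply, Fin.ext_iff, eq_comm]

/-- A matrix and a vector which specialize to the shift generate. -/
theorem det_iterMat_ne_zero_of_map_shift {B : Type*} [CommRing B] [CharP A p] [CharP B p]
    [Nontrivial B] (g : A →+* B) (G : Matrix (Fin d) (Fin d) A) (ξ : Fin d → A)
    (hG : G.map g = shiftMat B d) (hξ : mapVec _ g ξ = shiftVec B d) :
    (iterMat (matPhi p a G) ξ).det ≠ 0 := by
  intro h
  have := congrArg g h
  rw [RingHom.map_det, RingHom.mapMatrix_apply, iterMat_map, hG, hξ, iterMat_shift] at this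
  simp at this

variable (K d)

/-- A specialization with nonzero determinant is enough; for the shift, the matrix of iterates is
the identity. -/
theorem det_genericMat_ne_zero :
    (iterMat (matPhi p a (genericMat K d)) (genericVec K d)).det ≠ 0 :=
  det_iterMat_ne_zero_of_map_shift p a
    (specialize K (shiftMat K d) (shiftVec K d) : GenericRing K d →+* K) _ _
    (genericMat_map K _ _) (mapVec_genericVec K _ _)

open Polynomial in
theorem exists_isUniversalCoeffs (ha : 1 ≤ a) :
    ∃ P : Fin d → GenericRing K d, IsUniversalCoeffs K (p ^ a) d P := by
  let R := GenericRing K d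
  let F := FractionRing R
  let g := algebraMap R F
  have hg : Function.Injective g := IsFractionRing.injective R F
  have : CharP F p := charP_of_injective_algebraMap hg p
  let G := (genericMat K d).map g
  let ξ := mapVec _ g (genericVec K d)
  have hdet : (iterMat (matPhi p a G) ξ).det ≠ 0 := by
    rw [← iterMat_map, ← RingHom.mapMatrix_apply, ← RingHom.map_det]
    exact (map_ne_zero_iff g hg).2 (det_genericMat_ne_zero K p a d)
  -- Over the fraction field the linear system for the coefficients is solved by the inverse of the
  -- matrix of iterates.
  let c : Fin d → F := Matrix.vecMul ((matPhi p a G)^[d] ξ) (iterMat (matPhi p a G) ξ)⁻¹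
  have hc : act (matPhi p a G) (charOf c) ξ = 0 := by
    rw [act_charOf, sub_eq_zero]
    have h : Matrix.vecMul c (iterMat (matPhi p a G) ξ) = (matPhi p a G)^[d] ξ := by
      rw [Matrix.vecMul_vecMul, Matrix.nonsing_inv_mul _ (isUnit_iff_ne_zero.2 hdet),
        Matrix.vecMul_one]
    rw [← h]
    ext k
    simp [Matrix.vecMul, dotProduct, iterMat, Finset.sum_apply]
  obtain ⟨P, hP, hPx⟩ := exists_monic_act_eq_zero (matPhi p a (genericMat K d)) (genericVec K d)
  have hPx' : act (matPhi p a G) (P.map g) ξ = 0 := by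
    rw [← map_act (mapVec (Fin d) g) (mapVec_matPhi g _), hPx, map_zero]
  have hmem : ∀ n, (charOf c).coeff n ∈ Set.range g :=
    coeff_mem_range_of_act_eq_zero ha (matPhi p a G) ξ (monic_charOf c) hc
      (fun T hT h => eq_zero_of_act_eq_zero _ hdet (by rwa [natDegree_charOf] at hT) h) hP hPx'
  choose e he using fun i : Fin d => hmem i
  -- The sign comes from `charOf`, whose i-th coefficient is the opposite of the i-th entry of the
  -- family.
  refine ⟨fun i => - e i, (isUniversalCoeffs_iff K p a d _).2 ?_⟩
  have hmap : (charOf fun i => - e i).map g = charOf c := by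
    rw [map_charOf]
    congr 1
    ext i
    rw [map_neg, he, coeff_charOf, neg_neg]
  have : mapVec (Fin d) g
      (act (matPhi p a (genericMat K d)) (charOf fun i => - e i) (genericVec K d)) = 0 := by
    rw [map_act (mapVec (Fin d) g) (mapVec_matPhi g _), hmap]
    exact hc
  ext k : 1
  exact hg ((congrFun this k).trans (map_zero g).symm)

theorem existsUnique_isUniversalCoeffs (ha : 1 ≤ a) :
    ∃! P : Fin d → GenericRing K d, IsUniversalCoeffs K (p ^ a) d P := by
  obtain ⟨P, hP⟩ := exists_isUniversalCoeffs K p a d ha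
  refine ⟨P, hP, fun Q hQ => charOf_injective ?_⟩
  rw [isUniversalCoeffs_iff] at hP hQ
  exact eq_of_act_eq_zero _ (det_genericMat_ne_zero K p a d) (monic_charOf Q) (natDegree_charOf Q)
    (monic_charOf P) (natDegree_charOf P) hQ hP

end Generic

/-! ### The semi-characteristic polynomial of a matrix and a vector -/

section Chi

open Polynomial

variable (K : Type*) [Field K] (p a : ℕ) [Fact p.Prime] [CharP K p] {d : ℕ}
  {A : Type*} [CommRing A] [Algebra K A]

/-- The semi-characteristic polynomial of a matrix and a vector, as a polynomial. -/
def chi (G : Matrix (Fin d) (Fin d) A) (ξ : Fin d → A) : A[X] :=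
  charOf fun i => specialize K G ξ (universalCoeffs K (p ^ a) d i)

omit [Fact p.Prime] [CharP K p] in
theorem monic_chi (G : Matrix (Fin d) (Fin d) A) (ξ : Fin d → A) : (chi K p a G ξ).Monic :=
  monic_charOf _

omit [Fact p.Prime] [CharP K p] in
theorem natDegree_chi [Nontrivial A] (G : Matrix (Fin d) (Fin d) A) (ξ : Fin d → A) :
    (chi K p a G ξ).natDegree = d :=
  natDegree_charOf _

omit [Fact p.Prime] [CharP K p] in
theorem map_chi {B : Type*} [CommRing B] [Algebra K B] (g : A →ₐ[K] B)
    (G : Matrix (Fin d) (Fin d) A) (ξ : Fin d → A) :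
    (chi K p a G ξ).map (g : A →+* B) = chi K p a (G.map g) (mapVec _ (g : A →+* B) ξ) := by
  have h : g.comp (specialize K G ξ) =
      specialize K (G.map g) (mapVec _ (g : A →+* B) ξ) := by
    refine MvPolynomial.algHom_ext fun i => ?_
    rcases i with i | i <;> simp [specialize, mapVec_apply]
  rw [chi, map_charOf, chi, ← h]
  rfl

variable {K p a}

theorem isUniversalCoeffs_universalCoeffs (ha : 1 ≤ a) :
    IsUniversalCoeffs K (p ^ a) d (universalCoeffs K (p ^ a) d) := by
  have h := exists_isUniversalCoeffs K p a d ha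
  rw [universalCoeffs, dif_pos h]
  exact h.choose_spec

variable [CharP A p]

/-- The generic relation survives every specialization, whether or not ξ generates. -/
theorem act_chi (ha : 1 ≤ a) (G : Matrix (Fin d) (Fin d) A) (ξ : Fin d → A) :
    act (matPhi p a G) (chi K p a G ξ) ξ = 0 := by
  have h := (isUniversalCoeffs_iff K p a d _).1 (isUniversalCoeffs_universalCoeffs ha)
  have h2 := congrArg (mapVec _ (specialize K G ξ : GenericRing K d →+* A)) h
  rw [map_act _ (mapVec_matPhi _ _), map_zero, mapVec_genericVec, map_charOf] at h2
  have h3 := genericMat_map K G ξ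
  rw [show (genericMat K d).map (specialize K G ξ : GenericRing K d →+* A) = G from h3] at h2
  exact h2

/-- The criterion used on generic data: being monic, of degree d and killing ξ characterizes `chi`
once the iterates are independent. -/
theorem eq_chi [IsDomain A] (ha : 1 ≤ a) {G : Matrix (Fin d) (Fin d) A} {ξ : Fin d → A}
    (hdet : (iterMat (matPhi p a G) ξ).det ≠ 0) {Q : A[X]} (hQ : Q.Monic) (hd : Q.natDegree = d)
    (hx : act (matPhi p a G) Q ξ = 0) : Q = chi K p a G ξ :=
  eq_of_act_eq_zero _ hdet hQ hd (monic_chi K p a G ξ) (natDegree_chi K p a G ξ) hx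
    (act_chi ha G ξ)

end Chi

/-! ### Multiplicativity for block triangular matrices -/

section Block

open Polynomial

variable {K : Type*} [Field K] {p a : ℕ} [Fact p.Prime] [CharP K p] {e f : ℕ}
  {A : Type*} [CommRing A] [Algebra K A] [CharP A p]

/-- The projection to the first coordinates. -/
def firstCoords (A : Type*) [CommRing A] (f e : ℕ) : (Fin (f + e) → A) →ₗ[A] (Fin f → A) :=
  LinearMap.funLeft A A (Fin.castAdd e)

/-- The projection to the last coordinates. -/
def lastCoords (A : Type*) [CommRing A] (f e : ℕ) : (Fin (f + e) → A) →ₗ[A] (Fin e → A) :=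
  LinearMap.funLeft A A (Fin.natAdd f)

theorem firstCoords_apply (w : Fin (f + e) → A) (i : Fin f) :
    firstCoords A f e w i = w (Fin.castAdd e i) := rfl

theorem lastCoords_apply (w : Fin (f + e) → A) (i : Fin e) :
    lastCoords A f e w i = w (Fin.natAdd f i) := rfl

/-- Lower triangular block matrices. -/
def IsBlock (G : Matrix (Fin (f + e)) (Fin (f + e)) A) : Prop :=
  ∀ i j, G (Fin.castAdd e i) (Fin.natAdd f j) = 0

/-- The upper left block. -/
abbrev firstBlock (G : Matrix (Fin (f + e)) (Fin (f + e)) A) : Matrix (Fin f) (Fin f) A :=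
  G.submatrix (Fin.castAdd e) (Fin.castAdd e)

/-- The lower right block. -/
abbrev lastBlock (G : Matrix (Fin (f + e)) (Fin (f + e)) A) : Matrix (Fin e) (Fin e) A :=
  G.submatrix (Fin.natAdd f) (Fin.natAdd f)

theorem firstCoords_matPhi {G : Matrix (Fin (f + e)) (Fin (f + e)) A} (hG : IsBlock G)
    (w : Fin (f + e) → A) :
    firstCoords A f e (matPhi p a G w) = matPhi p a (firstBlock G) (firstCoords A f e w) := by
  ext i
  simp [firstCoords_apply, matPhi_apply, Fin.sum_univ_add, hG i _]

theorem lastCoords_matPhi (G : Matrix (Fin (f + e)) (Fin (f + e)) A)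
    {w : Fin (f + e) → A} (hw : firstCoords A f e w = 0) :
    lastCoords A f e (matPhi p a G w) = matPhi p a (lastBlock G) (lastCoords A f e w) := by
  have hq : p ^ a ≠ 0 := pow_ne_zero _ (Fact.out : p.Prime).ne_zero
  have h : ∀ i, w (Fin.castAdd e i) = 0 := fun i => congrFun hw i
  ext i
  simp [lastCoords_apply, matPhi_apply, Fin.sum_univ_add, h, zero_pow hq]

/-- Vectors with zero first coordinates form a stable subspace because of the zero block; the
vanishing is carried along the induction on iterates, since the last coordinates alone do not follow
`lastBlock` otherwise. -/
theorem lastCoords_act {G : Matrix (Fin (f + e)) (Fin (f + e)) A} (hG : IsBlock G)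
    {w : Fin (f + e) → A} (hw : firstCoords A f e w = 0) (P : A[X]) :
    lastCoords A f e (act (matPhi p a G) P w) =
      act (matPhi p a (lastBlock G)) P (lastCoords A f e w) := by
  have hn : ∀ n : ℕ, firstCoords A f e ((matPhi p a G)^[n] w) = 0 ∧
      lastCoords A f e ((matPhi p a G)^[n] w) =
        (matPhi p a (lastBlock G))^[n] (lastCoords A f e w) := by
    intro n
    induction n with
    | zero => exact ⟨hw, rfl⟩
    | succ n ih =>
      rw [Function.iterate_succ_apply', firstCoords_matPhi hG, ih.1, map_zero,
        lastCoords_matPhi G ih.1, ih.2, Function.iterate_succ_apply']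
      exact ⟨rfl, rfl⟩
  induction P using Polynomial.induction_on' with
  | add s t hs ht => simp [act_add, hs, ht]
  | monomial n c => simp [act_monomial, (hn n).2]

/-- Multiplicativity for a block triangular matrix and a generating vector. -/
theorem chi_block_of_det_ne_zero [IsDomain A] (ha : 1 ≤ a)
    {G : Matrix (Fin (f + e)) (Fin (f + e)) A}
    (hG : IsBlock G) {ξ : Fin (f + e) → A} (hdet : (iterMat (matPhi p a G) ξ).det ≠ 0) :
    chi K p a G ξ = skewMul p a
      (chi K p a (lastBlock G) (lastCoords A f e
        (act (matPhi p a G) (chi K p a (firstBlock G) (firstCoords A f e ξ)) ξ)))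
      (chi K p a (firstBlock G) (firstCoords A f e ξ)) := by
  symm
  have hfirst : firstCoords A f e
      (act (matPhi p a G) (chi K p a (firstBlock G) (firstCoords A f e ξ)) ξ) = 0 := by
    rw [map_act_linear _ (firstCoords_matPhi hG), act_chi ha]
  refine eq_chi ha hdet (monic_skewMul (monic_chi ..) (monic_chi ..)) ?_ ?_
  · rw [natDegree_skewMul_of_monic (monic_chi ..) (monic_chi ..), natDegree_chi, natDegree_chi,
      add_comm]
  · rw [act_skewMul]
    have h1 := map_act_linear (firstCoords A f e) (firstCoords_matPhi (p := p) (a := a) hG)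
      (chi K p a (lastBlock G) (lastCoords A f e
        (act (matPhi p a G) (chi K p a (firstBlock G) (firstCoords A f e ξ)) ξ)))
      (act (matPhi p a G) (chi K p a (firstBlock G) (firstCoords A f e ξ)) ξ)
    rw [hfirst, act_zero_right] at h1
    have h2 := lastCoords_act (p := p) (a := a) hG hfirst
      (chi K p a (lastBlock G) (lastCoords A f e
        (act (matPhi p a G) (chi K p a (firstBlock G) (firstCoords A f e ξ)) ξ)))
    rw [act_chi ha] at h2
    ext i
    refine Fin.addCases (fun j => ?_) (fun j => ?_) i
    · exact congrFun h1 j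
    · exact congrFun h2 j

variable (K e f) in
/-- The generic lower triangular block matrix. -/
def genericBlock : Matrix (Fin (f + e)) (Fin (f + e)) (GenericRing K (f + e)) :=
  Matrix.of fun i j => if (i : ℕ) < f ∧ f ≤ (j : ℕ) then 0 else genericMat K (f + e) i j

theorem isBlock_genericBlock : IsBlock (genericBlock K e f) := fun i j => by
  simp [genericBlock]

theorem genericBlock_map {G : Matrix (Fin (f + e)) (Fin (f + e)) A} (hG : IsBlock G)
    (ξ : Fin (f + e) → A) : (genericBlock K e f).map (specialize K G ξ) = G := by
  ext i j
  simp only [genericBlock, Matrix.map_apply, Matrix.of_apply]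
  split_ifs with h
  · rw [map_zero]
    exact (hG ⟨i, h.1⟩ ⟨j - f, by omega⟩).symm.trans
      (congrArg₂ G (Fin.ext (by simp)) (Fin.ext (by simp [h.2])))
  · exact congrFun₂ (genericMat_map K G ξ) i j

theorem isBlock_shiftMat : IsBlock (shiftMat A (f + e)) := fun i j => by
  simp only [shiftMat, Matrix.of_apply, Fin.val_castAdd, Fin.val_natAdd]
  rw [if_neg]
  omega

/-- Multiplicativity for a block triangular matrix. -/
theorem chi_block (ha : 1 ≤ a) {G : Matrix (Fin (f + e)) (Fin (f + e)) K} (hG : IsBlock G)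
    (ξ : Fin (f + e) → K) :
    chi K p a G ξ = skewMul p a
      (chi K p a (lastBlock G) (lastCoords K f e
        (act (matPhi p a G) (chi K p a (firstBlock G) (firstCoords K f e ξ)) ξ)))
      (chi K p a (firstBlock G) (firstCoords K f e ξ)) := by
  let g := specialize K G ξ
  let g' : GenericRing K (f + e) →+* K := g
  let G0 := genericBlock K e f
  let ξ0 := genericVec K (f + e)
  -- The shift is itself lower triangular by blocks, so imposing the zero block on the generic
  -- matrix still leaves it as a specialization.
  have hdet : (iterMat (matPhi p a G0) ξ0).det ≠ 0 :=
    det_iterMat_ne_zero_of_map_shift p a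
      (specialize K (shiftMat K (f + e)) (shiftVec K (f + e)) : GenericRing K (f + e) →+* K) _ _
      (genericBlock_map isBlock_shiftMat _) (mapVec_genericVec K _ _)
  have hGm : G0.map g' = G := genericBlock_map hG ξ
  have hξ : mapVec _ g' ξ0 = ξ := mapVec_genericVec K G ξ
  have hfm : (firstBlock G0).map g' = firstBlock G := by rw [← hGm]; rfl
  have hlm : (lastBlock G0).map g' = lastBlock G := by rw [← hGm]; rfl
  have hfv : mapVec _ g' (firstCoords _ f e ξ0) = firstCoords K f e ξ := by rw [← hξ]; rfl
  have hf : (chi K p a (firstBlock G0) (firstCoords _ f e ξ0)).map g' =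
      chi K p a (firstBlock G) (firstCoords K f e ξ) := by
    rw [map_chi K p a g]
    exact congrArg₂ (chi K p a) hfm hfv
  have hy : mapVec _ g' (lastCoords _ f e
        (act (matPhi p a G0) (chi K p a (firstBlock G0) (firstCoords _ f e ξ0)) ξ0)) =
      lastCoords K f e
        (act (matPhi p a G) (chi K p a (firstBlock G) (firstCoords K f e ξ)) ξ) := by
    have := map_act (mapVec _ g') (mapVec_matPhi (a := a) g' G0)
      (chi K p a (firstBlock G0) (firstCoords _ f e ξ0)) ξ0
    rw [hf, hGm, hξ] at this
    rw [← this]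
    rfl
  have key := congrArg (Polynomial.map g')
    (chi_block_of_det_ne_zero (K := K) ha isBlock_genericBlock hdet)
  rw [map_skewMul, hf, map_chi K p a g, map_chi K p a g] at key
  refine (congrArg₂ (chi K p a) hGm hξ).symm.trans (key.trans ?_)
  exact congrArg (fun P => skewMul p a P _) (congrArg₂ (chi K p a) hlm hy)

end Block

/-! ### Change of basis -/

section Conj

open Polynomial

variable {K : Type*} [Field K] {p a : ℕ} [Fact p.Prime] [CharP K p] {d : ℕ}

theorem map_mul_map_frob {A : Type*} [CommRing A] [CharP A p] (C H : Matrix (Fin d) (Fin d) A) :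
    (C * H).map (iterateFrobenius A p a) =
      C.map (iterateFrobenius A p a) * H.map (iterateFrobenius A p a) :=
  Matrix.map_mul

theorem matPhi_eq_mulVec {A : Type*} [CommRing A] [CharP A p] (G : Matrix (Fin d) (Fin d) A)
    (w : Fin d → A) :
    matPhi p a G w = G.mulVec (mapVec _ (iterateFrobenius A p a) w) := by
  ext i
  simp [matPhi_apply, Matrix.mulVec, dotProduct, mapVec_apply, iterateFrobenius_def]

theorem mulVec_matPhi {A : Type*} [CommRing A] [CharP A p] {C G H : Matrix (Fin d) (Fin d) A}
    (h : C * H = G * C.map (iterateFrobenius A p a)) (w : Fin d → A) :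
    C.mulVecLin (matPhi p a H w) = matPhi p a G (C.mulVecLin w) := by
  have : mapVec _ (iterateFrobenius A p a) (C.mulVec w) =
      (C.map (iterateFrobenius A p a)).mulVec (mapVec _ (iterateFrobenius A p a) w) :=
    mapVec_mulVec _ C w
  rw [matPhi_eq_mulVec, matPhi_eq_mulVec, Matrix.mulVecLin_apply, Matrix.mulVecLin_apply, this,
    Matrix.mulVec_mulVec, Matrix.mulVec_mulVec, h]

/-- Invariance of the semi-characteristic polynomial under a change of basis. -/
theorem chi_conj (ha : 1 ≤ a) {C G H : Matrix (Fin d) (Fin d) K} (hC : C.det ≠ 0)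
    (h : C * H = G * C.map (iterateFrobenius K p a)) (η : Fin d → K) :
    chi K p a G (C.mulVec η) = chi K p a H η := by
  let R := GenericRing K d
  let ι : K →+* R := algebraMap K R
  let H0 := genericMat K d
  let η0 := genericVec K d
  let C0 : Matrix (Fin d) (Fin d) R := C.map ι
  let D0 : Matrix (Fin d) (Fin d) R := C⁻¹.map ι
  -- Only H and η are made generic. The matrix C stays over K, hence invertible, and the change of
  -- basis relation then forces G0 = C H0 σ(C)⁻¹.
  let G0 : Matrix (Fin d) (Fin d) R := C0 * H0 * D0.map (iterateFrobenius R p a)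
  have hDC : D0 * C0 = 1 := by
    rw [← Matrix.map_mul, Matrix.nonsing_inv_mul _ (isUnit_iff_ne_zero.2 hC)]
    exact Matrix.map_one ι (map_zero ι) (map_one ι)
  have h0 : C0 * H0 = G0 * C0.map (iterateFrobenius R p a) := by
    rw [Matrix.mul_assoc _ (D0.map _), ← map_mul_map_frob, hDC,
      Matrix.map_one _ (map_zero _) (map_one _), Matrix.mul_one]
  have hinj : Function.Injective C0.mulVecLin := by
    intro v w hvw
    have := congrArg D0.mulVec hvw
    simpa [Matrix.mulVec_mulVec, hDC] using this
  have key : chi K p a G0 (C0.mulVec η0) = chi K p a H0 η0 := by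
    -- It remains to check that the left-hand polynomial kills η0; this can be tested after applying
    -- the injective C0, which intertwines the two semilinear maps.
    refine eq_chi ha (det_genericMat_ne_zero K p a d) (monic_chi ..) (natDegree_chi ..) ?_
    apply hinj
    rw [map_act_linear _ (mulVec_matPhi h0), map_zero]
    exact act_chi ha _ _
  let g := specialize K H η
  let g' : R →+* K := g
  have hgι : ∀ c, g' (ι c) = c := fun c => g.commutes c
  have hC0 : C0.map g' = C := by ext i j; exact hgι _
  have hD0 : D0.map g' = C⁻¹ := by ext i j; exact hgι _
  have hH0 : H0.map g' = H := genericMat_map K H η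
  have hη0 : mapVec _ g' η0 = η := mapVec_genericVec K H η
  have hG0 : G0.map g' = G := by
    have hD : (D0.map (iterateFrobenius R p a)).map g' = C⁻¹.map (iterateFrobenius K p a) := by
      rw [← hD0]
      ext i j
      simp [iterateFrobenius_def]
    rw [Matrix.map_mul, Matrix.map_mul, hC0, hH0, hD, h, Matrix.mul_assoc, ← map_mul_map_frob,
      Matrix.mul_nonsing_inv _ (isUnit_iff_ne_zero.2 hC),
      Matrix.map_one _ (map_zero _) (map_one _), Matrix.mul_one]
  have hv : mapVec _ g' (C0.mulVec η0) = C.mulVec η := by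
    rw [mapVec_mulVec, hC0, hη0]
  have key2 := congrArg (Polynomial.map g') key
  rw [map_chi K p a g, map_chi K p a g] at key2
  exact (congrArg₂ (chi K p a) hG0 hv).symm.trans (key2.trans (congrArg₂ (chi K p a) hH0 hη0))

end Conj

/-! ### Semi-characteristic polynomials of modules and exact sequences -/

section ModChar

open Polynomial Module

variable {K : Type*} [Field K] {p a : ℕ} [Fact p.Prime] [CharP K p]
  {V : Type*} [AddCommGroup V] [Module K V]

/-- The matrix of a semilinear map. -/
def phiMat {ι : Type*} (b : Basis ι K V) (φ : V →ₛₗ[iterateFrobenius K p a] V) : Matrix ι ι K :=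
  Matrix.of fun i j => b.repr (φ (b j)) i

theorem equivFun_phi {ι : Type*} [Fintype ι] (b : Basis ι K V)
    (φ : V →ₛₗ[iterateFrobenius K p a] V) (v : V) :
    b.equivFun (φ v) = matPhi p a (phiMat b φ) (b.equivFun v) := by
  have h : φ v = ∑ j, (b.equivFun v j) ^ p ^ a • φ (b j) := by
    conv_lhs => rw [← b.sum_equivFun v]
    simp only [map_sum, map_smulₛₗ, iterateFrobenius_def]
  ext i
  rw [h]
  simp [matPhi_apply, phiMat, mul_comm]

/-- The semi-characteristic polynomial, as a polynomial. -/
def modChar {d : ℕ} (b : Basis (Fin d) K V) (φ : V →ₛₗ[iterateFrobenius K p a] V) (x : V) : K[X] :=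
  chi K p a (phiMat b φ) (b.equivFun x)

theorem act_modChar (ha : 1 ≤ a) {d : ℕ} (b : Basis (Fin d) K V)
    (φ : V →ₛₗ[iterateFrobenius K p a] V) (x : V) : act φ (modChar b φ x) x = 0 := by
  apply b.equivFun.injective
  have := map_act_linear (Φ := φ) (Ψ := matPhi p a (phiMat b φ)) (b.equivFun : V →ₗ[K] _) (equivFun_phi b φ) (modChar b φ x) x
  rw [map_zero]
  exact this.trans (act_chi ha _ _)

theorem modChar_eq_modChar (ha : 1 ≤ a) {d d' : ℕ} (b : Basis (Fin d) K V)
    (b' : Basis (Fin d') K V) (φ : V →ₛₗ[iterateFrobenius K p a] V) (x : V) :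
    modChar b φ x = modChar b' φ x := by
  obtain rfl : d = d' := by
    rw [← Fintype.card_fin d, ← finrank_eq_card_basis b, finrank_eq_card_basis b',
      Fintype.card_fin]
  have hC : (b.toMatrix b').det ≠ 0 := by
    intro h
    have := congrArg Matrix.det (b.toMatrix_mul_toMatrix_flip b')
    rw [Matrix.det_mul, h, zero_mul, Matrix.det_one] at this
    exact zero_ne_one this
  have hv : ∀ v : V, (b.toMatrix b').mulVec (b'.equivFun v) = b.equivFun v := fun v =>
    b'.toMatrix_mulVec_repr b v
  have hcomm : b.toMatrix b' * phiMat b' φ =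
      phiMat b φ * (b.toMatrix b').map (iterateFrobenius K p a) := by
    ext i k
    have h1 := congrFun (hv (φ (b' k))) i
    have h2 := congrFun (equivFun_phi b φ (b' k)) i
    rw [h2] at h1
    simpa [Matrix.mul_apply, Matrix.mulVec, dotProduct, phiMat, matPhi_apply, Basis.toMatrix_apply,
      iterateFrobenius_def] using h1
  rw [modChar, modChar, ← hv x]
  exact chi_conj ha hC hcomm _

/-- A linear section of π splits V as V'' × V'. The quotient coordinates are put first so that a
stable subspace gives a lower triangular block matrix. -/
theorem exists_adapted_basis {V' V'' : Type*} [AddCommGroup V'] [Module K V'] [AddCommGroup V'']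
    [Module K V''] {i : V' →ₗ[K] V} {π : V →ₗ[K] V''} (hi : Function.Injective i)
    (hπ : Function.Surjective π) (hex : Function.Exact i π) {e f : ℕ} (b' : Basis (Fin e) K V')
    (b'' : Basis (Fin f) K V'') :
    ∃ b : Basis (Fin (f + e)) K V, (∀ v, firstCoords K f e (b.equivFun v) = b''.equivFun (π v)) ∧
      ∀ w, lastCoords K f e (b.equivFun (i w)) = b'.equivFun w := by
  obtain ⟨s, hs⟩ := π.exists_rightInverse_of_surjective (LinearMap.range_eq_top.2 hπ)
  have hs' : ∀ w, π (s w) = w := fun w => LinearMap.congr_fun hs w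
  have hπi : ∀ w, π (i w) = 0 := fun w => hex.apply_apply_eq_zero w
  let ℓ : (V'' × V') →ₗ[K] V := s.coprod i
  have hℓ : Function.Bijective ℓ := by
    constructor
    · rw [← LinearMap.ker_eq_bot, LinearMap.ker_eq_bot']
      rintro ⟨u, w⟩ h
      have h' : s u + i w = 0 := h
      have hu : u = 0 := by
        have := congrArg π h'
        simpa [hs', hπi] using this
      rw [hu, map_zero, zero_add] at h'
      rw [hu, (map_eq_zero_iff i hi).1 h']
      rfl
    · intro v
      obtain ⟨w, hw⟩ := (hex (v - s (π v))).1 (by rw [map_sub, hs', sub_self])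
      refine ⟨(π v, w), ?_⟩
      change s (π v) + i w = v
      rw [hw]
      abel
  let b : Basis (Fin (f + e)) K V :=
    ((b''.prod b').map (LinearEquiv.ofBijective ℓ hℓ)).reindex finSumFinEquiv
  have hb1 : ∀ j, b (Fin.castAdd e j) = s (b'' j) := fun j => by
    simp [b, ℓ]
  have hb2 : ∀ j, b (Fin.natAdd f j) = i (b' j) := fun j => by
    simp [b, ℓ]
  refine ⟨b, fun v => ?_, fun w => ?_⟩
  · have : (firstCoords K f e) ∘ₗ (b.equivFun : V →ₗ[K] _) = (b''.equivFun : V'' →ₗ[K] _) ∘ₗ π := by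
      refine b.ext fun j => ?_
      refine Fin.addCases (fun j => ?_) (fun j => ?_) j
      · ext k
        have : (Fin.castAdd e j = Fin.castAdd e k) ↔ j = k := by simp [Fin.ext_iff]
        have h2 : π (b (Fin.castAdd e j)) = b'' j := by rw [hb1, hs']
        simp [firstCoords_apply, h2, Finsupp.single_apply, this]
      · ext k
        have : Fin.natAdd f j ≠ Fin.castAdd e k := by
          intro h
          have := congrArg Fin.val h
          simp at this
          omega
        have h2 : π (b (Fin.natAdd f j)) = 0 := by rw [hb2, hπi]
        simp [firstCoords_apply, h2, this]
    exact LinearMap.congr_fun this v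
  · have : (lastCoords K f e) ∘ₗ (b.equivFun : V →ₗ[K] _) ∘ₗ i = (b'.equivFun : V' →ₗ[K] _) := by
      refine b'.ext fun j => ?_
      ext k
      have : (Fin.natAdd f j = Fin.natAdd f k) ↔ j = k := by simp [Fin.ext_iff]
      simp [lastCoords_apply, ← hb2, Finsupp.single_apply, this]
    exact LinearMap.congr_fun this w

/-- Multiplicativity of semi-characteristic polynomials in exact sequences. -/
theorem modChar_of_exact (ha : 1 ≤ a) {V' V'' : Type*} [AddCommGroup V'] [Module K V']
    [AddCommGroup V''] [Module K V''] {φ : V →ₛₗ[iterateFrobenius K p a] V}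
    {φ' : V' →ₛₗ[iterateFrobenius K p a] V'} {φ'' : V'' →ₛₗ[iterateFrobenius K p a] V''}
    {i : V' →ₗ[K] V} {π : V →ₗ[K] V''} (hi : Function.Injective i)
    (hπ : Function.Surjective π) (hex : Function.Exact i π)
    (hiφ : ∀ w, i (φ' w) = φ (i w)) (hπφ : ∀ v, π (φ v) = φ'' (π v))
    {d e f : ℕ} (b : Basis (Fin d) K V) (b' : Basis (Fin e) K V') (b'' : Basis (Fin f) K V'')
    {x : V} {y : V'} (hy : i y = act φ (modChar b'' φ'' (π x)) x) :
    modChar b φ x = skewMul p a (modChar b' φ' y) (modChar b'' φ'' (π x)) := by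
  obtain ⟨c, hc1, hc2⟩ := exists_adapted_basis hi hπ hex b' b''
  rw [modChar_eq_modChar ha b c]
  have hb1 : ∀ j, b''.equivFun (π (c (Fin.castAdd e j))) = Pi.single j 1 := fun j => by
    rw [← hc1]
    ext k
    have : (Fin.castAdd e j = Fin.castAdd e k) ↔ j = k := by simp [Fin.ext_iff]
    simp [firstCoords_apply, Finsupp.single_apply, Pi.single_apply, this, eq_comm]
  have hb1' : ∀ j, π (c (Fin.castAdd e j)) = b'' j := fun j => by
    apply b''.equivFun.injective
    rw [hb1]
    ext k
    simp [Pi.single_apply, eq_comm]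
  have hb2 : ∀ j, c (Fin.natAdd f j) = i (b' j) := fun j => by
    apply c.equivFun.injective
    ext k
    refine Fin.addCases (fun k => ?_) (fun k => ?_) k
    · have h := congrFun (hc1 (i (b' j))) k
      rw [hex.apply_apply_eq_zero, map_zero] at h
      rw [firstCoords_apply] at h
      rw [h]
      have : Fin.natAdd f j ≠ Fin.castAdd e k := by
        intro h
        have := congrArg Fin.val h
        simp at this
        omega
      simp [this]
    · have h := congrFun (hc2 (b' j)) k
      rw [lastCoords_apply] at h
      rw [h]
      have : (Fin.natAdd f j = Fin.natAdd f k) ↔ j = k := by simp [Fin.ext_iff]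
      simp [this]
  have hB : IsBlock (phiMat c φ) := fun k j => by
    have h := congrFun (hc1 (φ (c (Fin.natAdd f j)))) k
    rw [hπφ, hb2, hex.apply_apply_eq_zero, map_zero, map_zero, ← hb2] at h
    exact h
  have hfirst : firstBlock (phiMat c φ) = phiMat b'' φ'' := by
    ext k j
    have h := congrFun (hc1 (φ (c (Fin.castAdd e j)))) k
    rw [hπφ, hb1'] at h
    exact h
  have hlast : lastBlock (phiMat c φ) = phiMat b' φ' := by
    ext k j
    have h := congrFun (hc2 (φ' (b' j))) k
    rw [hiφ, ← hb2] at h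
    exact h
  have key := chi_block ha hB (c.equivFun x)
  rw [hfirst, hlast, hc1] at key
  have hact := map_act_linear (Φ := φ) (Ψ := matPhi p a (phiMat c φ)) (c.equivFun : V →ₗ[K] _) (equivFun_phi c φ)
    (modChar b'' φ'' (π x)) x
  rw [← hy] at hact
  have hy' : lastCoords K f e
      (act (matPhi p a (phiMat c φ)) (chi K p a (phiMat b'' φ'') (b''.equivFun (π x)))
        (c.equivFun x)) = b'.equivFun y := by
    rw [← hc2 y]
    exact congrArg _ hact.symm
  rw [hy'] at key
  exact key

end ModChar

/-! ### Cyclic submodules and generators -/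

section FinChar

open Polynomial Module

variable {K : Type*} [Field K] {p a : ℕ} [Fact p.Prime] [CharP K p]
  {V : Type*} [AddCommGroup V] [Module K V]

/-- The semi-characteristic polynomial with respect to any basis, as a polynomial. -/
def finChar [FiniteDimensional K V] (φ : V →ₛₗ[iterateFrobenius K p a] V) (x : V) : K[X] :=
  modChar (finBasis K V) φ x

/-- The sub-`φ`-module generated by `x`. -/
def cyc (φ : V →ₛₗ[iterateFrobenius K p a] V) (x : V) : Submodule K V :=
  Submodule.span K (Set.range fun n : ℕ => φ^[n] x)

variable {φ : V →ₛₗ[iterateFrobenius K p a] V} {x : V}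

theorem iterate_mem {N : Submodule K V} (hN : IsStable φ N) (hx : x ∈ N) (n : ℕ) :
    φ^[n] x ∈ N := by
  induction n with
  | zero => exact hx
  | succ n ih =>
    rw [Function.iterate_succ_apply']
    exact hN ih

theorem act_mem {N : Submodule K V} (hN : IsStable φ N) (hx : x ∈ N) (P : K[X]) :
    act φ P x ∈ N :=
  Submodule.sum_mem _ fun n _ => N.smul_mem _ (iterate_mem hN hx n)

theorem cyc_le {N : Submodule K V} (hN : IsStable φ N) (hx : x ∈ N) : cyc φ x ≤ N :=
  Submodule.span_le.2 (Set.range_subset_iff.2 fun n => iterate_mem hN hx n)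

theorem mem_cyc (φ : V →ₛₗ[iterateFrobenius K p a] V) (x : V) : x ∈ cyc φ x :=
  Submodule.subset_span ⟨0, rfl⟩

theorem isStable_cyc (φ : V →ₛₗ[iterateFrobenius K p a] V) (x : V) : IsStable φ (cyc φ x) := by
  refine Submodule.span_le.2 (Set.range_subset_iff.2 fun n => Submodule.subset_span ⟨n + 1, ?_⟩)
  exact Function.iterate_succ_apply' φ n x

theorem exists_act_of_mem_cyc {v : V} (hv : v ∈ cyc φ x) : ∃ P : K[X], v = act φ P x := by
  induction hv using Submodule.span_induction with
  | mem v h =>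
    obtain ⟨n, rfl⟩ := h
    exact ⟨monomial n 1, by rw [act_monomial, one_smul]⟩
  | zero => exact ⟨0, (act_zero φ x).symm⟩
  | add u v _ _ hu hv =>
    obtain ⟨P, rfl⟩ := hu
    obtain ⟨Q, rfl⟩ := hv
    exact ⟨P + Q, (act_add φ P Q x).symm⟩
  | smul c v _ hv =>
    obtain ⟨P, rfl⟩ := hv
    refine ⟨skewMul p a (monomial 0 c) P, ?_⟩
    rw [act_skewMul, act_monomial]
    rfl

/-- Right division by P replaces any polynomial in φ applied to x by its remainder, so the iterates
of order below deg P already span. -/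
theorem finrank_cyc_le {P : K[X]} (hP : P.Monic) (hx : act φ P x = 0) :
    finrank K (cyc φ x) ≤ P.natDegree := by
  have h : cyc φ x ≤ Submodule.span K (Set.range fun i : Fin P.natDegree => φ^[(i : ℕ)] x) := by
    intro v hv
    obtain ⟨Q, rfl⟩ := exists_act_of_mem_cyc hv
    obtain ⟨S, R, rfl, hR⟩ := exists_eq_skewMul_add p a hP Q
    rw [act_add, act_skewMul, hx, act_zero_right, zero_add, act_eq_sum_fin φ hR]
    exact Submodule.sum_mem _ fun i _ => Submodule.smul_mem _ _ (Submodule.subset_span ⟨i, rfl⟩)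
  have := FiniteDimensional.span_of_finite K
    (Set.finite_range fun i : Fin P.natDegree => φ^[(i : ℕ)] x)
  refine (Submodule.finrank_mono h).trans ((finrank_range_le_card _).trans ?_)
  rw [Fintype.card_fin]

/-- A generator is not killed by nonzero polynomials of small degree. -/
theorem Generates.eq_zero_of_act_eq_zero (hx : Generates φ x) {T : K[X]}
    (hT : T.degree < finrank K V) (h : act φ T x = 0) : T = 0 := by
  by_contra h0
  have hmonic : (T * C T.leadingCoeff⁻¹).Monic := monic_mul_leadingCoeff_inv h0
  -- Scaling all coefficients by a constant is a left skew multiplication, since σ^0 is the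
  -- identity; hence normalizing T to be monic keeps the annihilation of x.
  have heq : T * C T.leadingCoeff⁻¹ = skewMul p a (monomial 0 T.leadingCoeff⁻¹) T := by
    rw [skewMul_monomial_left, mul_comm, monomial_zero_left]
    congr 1
    ext n
    simp
  have hle := finrank_cyc_le (φ := φ) (x := x) hmonic (by
    rw [heq, act_skewMul, h, act_zero_right])
  rw [show cyc φ x = ⊤ from hx, finrank_top, natDegree_mul_leadingCoeff_inv _ h0] at hle
  rw [degree_eq_natDegree h0] at hT
  exact absurd hle (not_le.2 (by exact_mod_cast hT))

variable [FiniteDimensional K V]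

theorem monic_finChar (φ : V →ₛₗ[iterateFrobenius K p a] V) (x : V) : (finChar φ x).Monic :=
  monic_chi ..

theorem natDegree_finChar (φ : V →ₛₗ[iterateFrobenius K p a] V) (x : V) :
    (finChar φ x).natDegree = finrank K V :=
  natDegree_chi ..

theorem act_finChar (ha : 1 ≤ a) (φ : V →ₛₗ[iterateFrobenius K p a] V) (x : V) :
    act φ (finChar φ x) x = 0 :=
  act_modChar ha _ φ x

theorem modChar_eq_finChar (ha : 1 ≤ a) {d : ℕ} (b : Basis (Fin d) K V)
    (φ : V →ₛₗ[iterateFrobenius K p a] V) (x : V) : modChar b φ x = finChar φ x :=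
  modChar_eq_modChar ha _ _ φ x

theorem Generates.eq_finChar (ha : 1 ≤ a) (hx : Generates φ x) {Q : K[X]} (hQ : Q.Monic)
    (hd : Q.natDegree = finrank K V) (h : act φ Q x = 0) : Q = finChar φ x := by
  have hP := monic_finChar φ x
  rw [← sub_eq_zero]
  refine hx.eq_zero_of_act_eq_zero ?_ ?_
  · rw [← hd, ← degree_eq_natDegree hQ.ne_zero]
    refine degree_sub_lt_left ?_ hQ.ne_zero (by rw [hP.leadingCoeff, hQ.leadingCoeff])
    rw [degree_eq_natDegree hP.ne_zero, degree_eq_natDegree hQ.ne_zero, hd, natDegree_finChar]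
  · have := map_sub (actHom φ x) Q (finChar φ x)
    change act φ (Q - finChar φ x) x = act φ Q x - act φ (finChar φ x) x at this
    rw [this, h, act_finChar ha, sub_zero]

section Exact

variable {V' V'' : Type*} [AddCommGroup V'] [Module K V']
    [AddCommGroup V''] [Module K V''] {φ' : V' →ₛₗ[iterateFrobenius K p a] V'}
    {φ'' : V'' →ₛₗ[iterateFrobenius K p a] V''} {i : V' →ₗ[K] V} {π : V →ₗ[K] V''}

omit [FiniteDimensional K V] in
theorem Generates.map (hx : Generates φ x) (hπ : Function.Surjective π)
    (hπφ : ∀ v, π (φ v) = φ'' (π v)) : Generates φ'' (π x) := by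
  refine (eq_top_iff.2 fun w _ => ?_ : cyc φ'' (π x) = ⊤)
  obtain ⟨v, rfl⟩ := hπ w
  have hv : v ∈ cyc φ x := by
    rw [show cyc φ x = ⊤ from hx]
    trivial
  obtain ⟨P, rfl⟩ := exists_act_of_mem_cyc hv
  rw [map_act_linear π hπφ]
  exact act_mem (isStable_cyc _ _) (mem_cyc _ _) P

variable [FiniteDimensional K V'] [FiniteDimensional K V'']

theorem finChar_of_exact (ha : 1 ≤ a) (hi : Function.Injective i)
    (hπ : Function.Surjective π) (hex : Function.Exact i π)
    (hiφ : ∀ w, i (φ' w) = φ (i w)) (hπφ : ∀ v, π (φ v) = φ'' (π v))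
    {y : V'} (hy : i y = act φ (finChar φ'' (π x)) x) :
    finChar φ x = skewMul p a (finChar φ' y) (finChar φ'' (π x)) :=
  modChar_of_exact ha hi hπ hex hiφ hπφ _ _ _ hy

-- An element of V' is P(φ)(x) for some P. Dividing P on the right by the polynomial of the quotient
-- leaves a remainder that kills the generator π x in degree below dim V'', hence is zero; the
-- quotient of the division applied to y gives the element back.
omit [FiniteDimensional K V] [FiniteDimensional K V'] in
theorem Generates.of_exact (hx : Generates φ x) (hi : Function.Injective i)
    (hπ : Function.Surjective π) (hex : Function.Exact i π)
    (hiφ : ∀ w, i (φ' w) = φ (i w)) (hπφ : ∀ v, π (φ v) = φ'' (π v))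
    {y : V'} (hy : i y = act φ (finChar φ'' (π x)) x) (ha : 1 ≤ a) : Generates φ' y := by
  refine (eq_top_iff.2 fun w _ => ?_ : cyc φ' y = ⊤)
  have hv : i w ∈ cyc φ x := by
    rw [show cyc φ x = ⊤ from hx]
    trivial
  obtain ⟨P, hP⟩ := exists_act_of_mem_cyc hv
  obtain ⟨S, R, rfl, hR⟩ := exists_eq_skewMul_add p a (monic_finChar φ'' (π x)) P
  have hR0 : R = 0 := by
    rw [natDegree_finChar] at hR
    refine (hx.map hπ hπφ).eq_zero_of_act_eq_zero hR ?_
    have h := congrArg π hP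
    rw [hex.apply_apply_eq_zero, map_act_linear π hπφ, act_add, act_skewMul, act_finChar ha,
      act_zero_right, zero_add] at h
    exact h.symm
  rw [hR0, add_zero, act_skewMul, ← hy, ← map_act_linear i hiφ] at hP
  rw [hi hP]
  exact act_mem (isStable_cyc _ _) (mem_cyc _ _) S

end Exact

end FinChar

/-! ### Transfer to K[X, σ], degrees and irreducibility -/

section Bridge

open Module

variable {K : Type*} [Field K] {p a : ℕ} [Fact p.Prime] [CharP K p]

namespace SkewPoly

theorem ext_coeff {P Q : SkewPoly K p a} (h : ∀ n, P.coeff n = Q.coeff n) : P = Q :=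
  SkewMonoidAlgebra.ext fun n => h (Multiplicative.toAdd n)

theorem coeff_add (P Q : SkewPoly K p a) (n : ℕ) : (P + Q).coeff n = P.coeff n + Q.coeff n :=
  DFunLike.congr_fun (SkewMonoidAlgebra.coeff_add (k := K) (G := Multiplicative ℕ) P Q)
    (Multiplicative.ofAdd n)

theorem coeff_monomial (m n : ℕ) (c : K) :
    (monomial m c : SkewPoly K p a).coeff n = if m = n then c else 0 :=
  SkewPolynomial.coeff_monomial

theorem monomial_zero_one : (monomial 0 1 : SkewPoly K p a) = 1 := rfl

/-- A skew polynomial as a polynomial with the same coefficients. -/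
def toPoly : SkewPoly K p a →+ Polynomial K where
  toFun P := SkewPolynomial.sum P fun n c => Polynomial.monomial n c
  map_zero' := rfl
  map_add' P Q := SkewMonoidAlgebra.sum_add_index' (by simp) (by simp)

theorem toPoly_monomial (n : ℕ) (c : K) :
    toPoly (monomial n c : SkewPoly K p a) = Polynomial.monomial n c :=
  SkewPolynomial.sum_monomial_index (h := fun n c => Polynomial.monomial n c) (by simp)

theorem induction_monomial {motive : SkewPoly K p a → Prop} (P : SkewPoly K p a)
    (h0 : motive 0) (hadd : ∀ P Q, motive P → motive Q → motive (P + Q))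
    (hmon : ∀ n c, motive (monomial n c)) : motive P :=
  SkewPolynomial.induction P h0 fun n c _ _ _ h => hadd _ _ (hmon n c) h

theorem coeff_toPoly (P : SkewPoly K p a) (n : ℕ) : (toPoly P).coeff n = P.coeff n := by
  induction P using induction_monomial with
  | h0 => rfl
  | hadd P Q hP hQ => rw [map_add, Polynomial.coeff_add, hP, hQ, coeff_add]
  | hmon m c => rw [toPoly_monomial, coeff_monomial, Polynomial.coeff_monomial]

theorem toPoly_injective : Function.Injective (toPoly : SkewPoly K p a → Polynomial K) :=
  fun P Q h => ext_coeff fun n => by rw [← coeff_toPoly, ← coeff_toPoly, h]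

theorem toPoly_mul (P Q : SkewPoly K p a) :
    toPoly (P * Q) = skewMul p a (toPoly P) (toPoly Q) := by
  induction P using induction_monomial with
  | h0 => simp [skewMul]
  | hadd P P' hP hP' => rw [add_mul, map_add, map_add, hP, hP', skewMul_add_left]
  | hmon m c =>
    induction Q using induction_monomial with
    | h0 => simp [skewMul, Polynomial.sum_def]
    | hadd Q Q' hQ hQ' => rw [mul_add, map_add, map_add, hQ, hQ', skewMul_add_right]
    | hmon n e =>
      rw [monomial_mul_monomial, toPoly_monomial, toPoly_monomial, toPoly_monomial,
        skewMul_monomial_monomial, iterateFrobenius_def, pow_mul]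

theorem toPoly_one : toPoly (1 : SkewPoly K p a) = 1 := by
  rw [← monomial_zero_one, toPoly_monomial, Polynomial.monomial_zero_left, map_one]

theorem monic_iff (P : SkewPoly K p a) : P.Monic ↔ (toPoly P).Monic := by
  constructor
  · rintro ⟨n, h1, h2⟩
    refine Polynomial.monic_of_natDegree_le_of_coeff_eq_one n ?_ (by rw [coeff_toPoly, h1])
    exact Polynomial.natDegree_le_iff_coeff_eq_zero.2 fun k hk => by rw [coeff_toPoly, h2 k hk]
  · intro h
    refine ⟨(toPoly P).natDegree, by rw [← coeff_toPoly, h.coeff_natDegree], fun k hk => ?_⟩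
    rw [← coeff_toPoly, Polynomial.coeff_eq_zero_of_natDegree_lt hk]

/-- The degree of a skew polynomial. -/
def deg (P : SkewPoly K p a) : ℕ := (toPoly P).natDegree

theorem toPoly_ne_zero {P : SkewPoly K p a} (h : P ≠ 0) : toPoly P ≠ 0 := by
  rwa [Ne, map_eq_zero_iff _ toPoly_injective]

/-- The twist of a nonzero leading coefficient is nonzero because σ is injective on a field. -/
theorem mul_ne_zero_and_deg_mul {P Q : SkewPoly K p a} (hP : P ≠ 0) (hQ : Q ≠ 0) :
    P * Q ≠ 0 ∧ (P * Q).deg = P.deg + Q.deg := by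
  have hP' := toPoly_ne_zero hP
  have hQ' := toPoly_ne_zero hQ
  have h : (toPoly (P * Q)).coeff (P.deg + Q.deg) ≠ 0 := by
    rw [toPoly_mul, deg, deg, coeff_skewMul_add le_rfl le_rfl]
    refine mul_ne_zero (Polynomial.leadingCoeff_ne_zero.2 hP') ?_
    exact (map_ne_zero _).2 (Polynomial.leadingCoeff_ne_zero.2 hQ')
  refine ⟨?_, le_antisymm ?_ (Polynomial.le_natDegree_of_ne_zero h)⟩
  · intro h0
    rw [h0] at h
    exact h (by simp)
  · rw [deg, toPoly_mul]
    exact natDegree_skewMul_le _ _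

theorem deg_one : (1 : SkewPoly K p a).deg = 0 := by rw [deg, toPoly_one, Polynomial.natDegree_one]

theorem one_ne_zero' : (1 : SkewPoly K p a) ≠ 0 := by
  intro h
  have := congrArg toPoly h
  rw [toPoly_one, map_zero] at this
  exact one_ne_zero this

instance : Nontrivial (SkewPoly K p a) := ⟨1, 0, one_ne_zero'⟩

theorem isUnit_iff {P : SkewPoly K p a} (hP : P ≠ 0) : IsUnit P ↔ P.deg = 0 := by
  constructor
  · intro h
    obtain ⟨Q, hQ⟩ := h.exists_right_inv
    have hQ0 : Q ≠ 0 := by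
      rintro rfl
      rw [mul_zero] at hQ
      exact one_ne_zero' hQ.symm
    have := (mul_ne_zero_and_deg_mul hP hQ0).2
    rw [hQ, deg_one] at this
    omega
  · intro h
    obtain ⟨c, hc⟩ : ∃ c : K, P = monomial 0 c := by
      refine ⟨(toPoly P).coeff 0, toPoly_injective ?_⟩
      rw [toPoly_monomial, Polynomial.monomial_zero_left]
      exact Polynomial.eq_C_of_natDegree_eq_zero h
    have hc0 : c ≠ 0 := by
      rintro rfl
      exact hP (by rw [hc]; exact SkewPolynomial.monomial_zero_right 0)
    refine isUnit_iff_exists.2 ⟨monomial 0 c⁻¹, ?_, ?_⟩ <;>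
      rw [hc, monomial_mul_monomial, ← monomial_zero_one] <;> simp [hc0]

theorem irreducible_iff_deg {P : SkewPoly K p a} (hP : P ≠ 0) :
    Irreducible P ↔ P.deg ≠ 0 ∧ ∀ S R : SkewPoly K p a, P = S * R → S.deg = 0 ∨ R.deg = 0 := by
  have hne : ∀ S R : SkewPoly K p a, P = S * R → S ≠ 0 ∧ R ≠ 0 := by
    rintro S R rfl
    exact ⟨left_ne_zero_of_mul hP, right_ne_zero_of_mul hP⟩
  rw [irreducible_iff, isUnit_iff hP]
  refine and_congr Iff.rfl ⟨fun h S R hSR => ?_, fun h S R hSR => ?_⟩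
  · rw [← isUnit_iff (hne S R hSR).1, ← isUnit_iff (hne S R hSR).2]
    exact h hSR
  · rw [isUnit_iff (hne S R hSR).1, isUnit_iff (hne S R hSR).2]
    exact h S R hSR

theorem Monic.ne_zero {P : SkewPoly K p a} (h : P.Monic) : P ≠ 0 := by
  rintro rfl
  exact ((monic_iff _).1 h).ne_zero (map_zero _)

theorem Monic.mul {P Q : SkewPoly K p a} (hP : P.Monic) (hQ : Q.Monic) : (P * Q).Monic := by
  rw [monic_iff] at *
  rw [toPoly_mul]
  exact monic_skewMul hP hQ

theorem monic_one : (1 : SkewPoly K p a).Monic := by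
  rw [monic_iff, toPoly_one]
  exact Polynomial.monic_one

end SkewPoly

open SkewPoly

variable {V : Type*} [AddCommGroup V] [Module K V]

theorem evalAt_eq_act (φ : V →ₛₗ[iterateFrobenius K p a] V) (P : SkewPoly K p a) (x : V) :
    evalAt φ P x = act φ (toPoly P) x := by
  have hadd : ∀ P Q : SkewPoly K p a, evalAt φ (P + Q) x = evalAt φ P x + evalAt φ Q x :=
    fun P Q => SkewMonoidAlgebra.sum_add_index' (by simp) (by simp [add_smul])
  induction P using induction_monomial with
  | h0 => rw [map_zero, act_zero]; rfl
  | hadd P Q hP hQ => rw [hadd, map_add, act_add, hP, hQ]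
  | hmon n c =>
    rw [toPoly_monomial, act_monomial]
    exact SkewPolynomial.sum_monomial_index (by simp)

theorem evalAt_mul (φ : V →ₛₗ[iterateFrobenius K p a] V) (P Q : SkewPoly K p a) (x : V) :
    evalAt φ (P * Q) x = evalAt φ P (evalAt φ Q x) := by
  rw [evalAt_eq_act, evalAt_eq_act, evalAt_eq_act, toPoly_mul, act_skewMul]

theorem evalAt_one (φ : V →ₛₗ[iterateFrobenius K p a] V) (x : V) : evalAt φ 1 x = x := by
  rw [evalAt_eq_act, toPoly_one, ← Polynomial.monomial_zero_one, act_monomial]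
  simp

theorem evalAt_mem {φ : V →ₛₗ[iterateFrobenius K p a] V} {N : Submodule K V} (hN : IsStable φ N)
    {x : V} (hx : x ∈ N) (P : SkewPoly K p a) : evalAt φ P x ∈ N := by
  rw [evalAt_eq_act]
  exact act_mem hN hx _

theorem map_evalAt {W : Type*} [AddCommGroup W] [Module K W]
    {φ : V →ₛₗ[iterateFrobenius K p a] V} {ψ : W →ₛₗ[iterateFrobenius K p a] W}
    (f : V →ₗ[K] W) (h : ∀ x, f (φ x) = ψ (f x)) (P : SkewPoly K p a) (x : V) :
    f (evalAt φ P x) = evalAt ψ P (f x) := by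
  rw [evalAt_eq_act, evalAt_eq_act, map_act_linear f h]

theorem toPoly_semiChar {d : ℕ} (b : Basis (Fin d) K V) (φ : V →ₛₗ[iterateFrobenius K p a] V)
    (x : V) : toPoly (semiChar b φ x) = modChar b φ x := by
  rw [semiChar, map_sub, map_sum, toPoly_monomial, Polynomial.monomial_one_right_eq_X_pow]
  simp only [toPoly_monomial]
  rfl

variable [FiniteDimensional K V]

/-- The semi-characteristic polynomial with respect to any basis. -/
def semiCharOf (φ : V →ₛₗ[iterateFrobenius K p a] V) (x : V) : SkewPoly K p a :=
  semiChar (finBasis K V) φ x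

theorem toPoly_semiCharOf (φ : V →ₛₗ[iterateFrobenius K p a] V) (x : V) :
    toPoly (semiCharOf φ x) = finChar φ x :=
  toPoly_semiChar _ φ x

theorem semiChar_eq_semiCharOf (ha : 1 ≤ a) {d : ℕ} (b : Basis (Fin d) K V)
    (φ : V →ₛₗ[iterateFrobenius K p a] V) (x : V) : semiChar b φ x = semiCharOf φ x :=
  toPoly_injective (by
    rw [toPoly_semiChar, toPoly_semiCharOf, modChar_eq_finChar ha])

theorem monic_semiCharOf (φ : V →ₛₗ[iterateFrobenius K p a] V) (x : V) :
    (semiCharOf φ x).Monic := by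
  rw [monic_iff, toPoly_semiCharOf]
  exact monic_finChar φ x

theorem deg_semiCharOf (φ : V →ₛₗ[iterateFrobenius K p a] V) (x : V) :
    (semiCharOf φ x).deg = finrank K V := by
  rw [deg, toPoly_semiCharOf, natDegree_finChar]

theorem evalAt_semiCharOf (ha : 1 ≤ a) (φ : V →ₛₗ[iterateFrobenius K p a] V) (x : V) :
    evalAt φ (semiCharOf φ x) x = 0 := by
  rw [evalAt_eq_act, toPoly_semiCharOf, act_finChar ha]

theorem Generates.eq_semiCharOf (ha : 1 ≤ a) {φ : V →ₛₗ[iterateFrobenius K p a] V} {x : V}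
    (hx : Generates φ x) {Q : SkewPoly K p a} (hQ : Q.Monic) (hd : Q.deg = finrank K V)
    (h : evalAt φ Q x = 0) : Q = semiCharOf φ x :=
  toPoly_injective (by
    rw [toPoly_semiCharOf]
    rw [evalAt_eq_act] at h
    exact hx.eq_finChar ha ((monic_iff Q).1 hQ) hd h)

section Exact

variable {V' V'' : Type*} [AddCommGroup V'] [Module K V']
    [AddCommGroup V''] [Module K V''] {φ : V →ₛₗ[iterateFrobenius K p a] V} {x : V}
    {φ' : V' →ₛₗ[iterateFrobenius K p a] V'}
    {φ'' : V'' →ₛₗ[iterateFrobenius K p a] V''} {i : V' →ₗ[K] V} {π : V →ₗ[K] V''}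
    [FiniteDimensional K V'] [FiniteDimensional K V'']

theorem semiCharOf_of_exact (ha : 1 ≤ a) (hi : Function.Injective i)
    (hπ : Function.Surjective π) (hex : Function.Exact i π)
    (hiφ : ∀ w, i (φ' w) = φ (i w)) (hπφ : ∀ v, π (φ v) = φ'' (π v))
    {y : V'} (hy : i y = evalAt φ (semiCharOf φ'' (π x)) x) :
    semiCharOf φ x = semiCharOf φ' y * semiCharOf φ'' (π x) :=
  toPoly_injective (by
    rw [evalAt_eq_act, toPoly_semiCharOf] at hy
    rw [toPoly_mul, toPoly_semiCharOf, toPoly_semiCharOf, toPoly_semiCharOf]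
    exact finChar_of_exact ha hi hπ hex hiφ hπφ hy)

end Exact

/-- The semi-characteristic polynomial of a simple `φ`-module in a nonzero vector is
irreducible. -/
theorem IsSimplePhi.irreducible_semiCharOf (ha : 1 ≤ a)
    {φ : V →ₛₗ[iterateFrobenius K p a] V} (hs : IsSimplePhi φ) {y : V} (hy : y ≠ 0) :
    Irreducible (semiCharOf φ y) := by
  have hgen : ∀ z : V, z ≠ 0 → cyc φ z = ⊤ := fun z hz =>
    (hs.2 _ (isStable_cyc φ z)).resolve_left fun h => hz (by
      have := mem_cyc φ z
      rwa [h, Submodule.mem_bot] at this)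
  have hne := (monic_semiCharOf φ y).ne_zero
  have := hs.1
  rw [irreducible_iff_deg hne, deg_semiCharOf]
  refine ⟨finrank_pos.ne', fun S R hSR => ?_⟩
  have hS : S ≠ 0 := by
    rintro rfl
    exact hne (by rw [hSR, zero_mul])
  have hR : R ≠ 0 := by
    rintro rfl
    exact hne (by rw [hSR, mul_zero])
  have hdeg := (mul_ne_zero_and_deg_mul hS hR).2
  rw [← hSR, deg_semiCharOf] at hdeg
  by_contra! hcon
  -- Applied first to R and y, then to S and R(φ)(y): both vectors generate, and both factors have
  -- degree below the dimension once neither is constant.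
  have hkill : ∀ (T : SkewPoly K p a) (z : V), T ≠ 0 → z ≠ 0 → T.deg < finrank K V →
      evalAt φ T z ≠ 0 := by
    intro T z hT hz hd h
    rw [evalAt_eq_act] at h
    refine toPoly_ne_zero hT (Generates.eq_zero_of_act_eq_zero (hgen z hz) ?_ h)
    rw [Polynomial.degree_eq_natDegree (toPoly_ne_zero hT)]
    exact_mod_cast hd
  refine hkill S (evalAt φ R y) hS (hkill R y hR hy (by omega)) (by omega) ?_
  rw [← evalAt_mul, ← hSR, evalAt_semiCharOf ha]

/-- Degrees add, so degree one forces irreducibility; y = 0 is allowed. -/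
theorem irreducible_semiCharOf_of_finrank_eq_one (φ : V →ₛₗ[iterateFrobenius K p a] V) (y : V)
    (h : finrank K V = 1) : Irreducible (semiCharOf φ y) := by
  have hne := (monic_semiCharOf φ y).ne_zero
  rw [irreducible_iff_deg hne, deg_semiCharOf, h]
  refine ⟨one_ne_zero, fun S R hSR => ?_⟩
  have hS : S ≠ 0 := by
    rintro rfl
    exact hne (by rw [hSR, zero_mul])
  have hR : R ≠ 0 := by
    rintro rfl
    exact hne (by rw [hSR, mul_zero])
  have hdeg := (mul_ne_zero_and_deg_mul hS hR).2
  rw [← hSR, deg_semiCharOf, h] at hdeg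
  omega

end Bridge

/-! ### Stable subspaces and subquotients -/

section Subquotient

open Module SkewPoly

variable {K : Type*} [Field K] {p a : ℕ} [Fact p.Prime] [CharP K p]
  {V : Type*} [AddCommGroup V] [Module K V] {φ : V →ₛₗ[iterateFrobenius K p a] V}

theorem mem_submoduleOf_iff {N N' : Submodule K V} {w : N} :
    w ∈ N'.submoduleOf N ↔ (w : V) ∈ N' := Iff.rfl

theorem coe_evalAt_restrictPhi {N : Submodule K V} (hN : IsStable φ N) (P : SkewPoly K p a)
    (w : N) : ((evalAt (restrictPhi φ N hN) P w : N) : V) = evalAt φ P w :=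
  map_evalAt N.subtype (fun _ => rfl) P w

theorem mk_evalAt {N N' : Submodule K V} (hN : IsStable φ N) (hN' : IsStable φ N')
    (P : SkewPoly K p a) (w : N) :
    (N'.submoduleOf N).mkQ (evalAt (restrictPhi φ N hN) P w) =
      evalAt (subquotientPhi φ N N' hN hN') P ((N'.submoduleOf N).mkQ w) :=
  map_evalAt _ (fun _ => rfl) P w

theorem exact_inclusion_mkQ {N N' : Submodule K V} (h : N' ≤ N) :
    Function.Exact (Submodule.inclusion h) (N'.submoduleOf N).mkQ := by
  intro w
  rw [Submodule.mkQ_apply, Submodule.Quotient.mk_eq_zero, mem_submoduleOf_iff]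
  constructor
  · intro hw
    exact ⟨⟨w, hw⟩, rfl⟩
  · rintro ⟨u, rfl⟩
    exact u.2

theorem generates_restrictPhi_iff {N : Submodule K V} (hN : IsStable φ N) (w : N) :
    Generates (restrictPhi φ N hN) w ↔ cyc φ (w : V) = N := by
  have hit : ∀ n : ℕ, (((restrictPhi φ N hN)^[n] w : N) : V) = φ^[n] (w : V) := by
    intro n
    induction n with
    | zero => rfl
    | succ n ih =>
      rw [Function.iterate_succ_apply', Function.iterate_succ_apply', ← ih]
      rfl
  have hmap : (cyc (restrictPhi φ N hN) w).map N.subtype = cyc φ (w : V) := by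
    rw [cyc, cyc, Submodule.map_span, ← Set.range_comp]
    congr 2
    ext n
    exact hit n
  rw [← hmap]
  constructor
  · intro h
    rw [show cyc (restrictPhi φ N hN) w = ⊤ from h, Submodule.map_top, Submodule.range_subtype]
  · intro h
    refine (Submodule.map_injective_of_injective N.injective_subtype ?_ :
      cyc (restrictPhi φ N hN) w = ⊤)
    rw [h, Submodule.map_top, Submodule.range_subtype]

theorem cyc_zero : cyc φ (0 : V) = ⊥ :=
  eq_bot_iff.2 (cyc_le (by simp [IsStable]) (Submodule.zero_mem _))

theorem Generates.ne_zero [Nontrivial V] {x : V} (h : Generates φ x) : x ≠ 0 := by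
  rintro rfl
  have : cyc φ (0 : V) = ⊤ := h
  rw [cyc_zero] at this
  exact bot_ne_top this

theorem SkewPoly.Monic.eq_one {P : SkewPoly K p a} (hP : P.Monic) (h : P.deg = 0) : P = 1 :=
  toPoly_injective (by
    rw [toPoly_one]
    exact ((monic_iff P).1 hP).natDegree_eq_zero.1 h)

variable [FiniteDimensional K V]

theorem evalAt_semiCharOf_mem (ha : 1 ≤ a) {N N' : Submodule K V} (hN : IsStable φ N)
    (hN' : IsStable φ N') (w : N) :
    evalAt φ (semiCharOf (subquotientPhi φ N N' hN hN') ((N'.submoduleOf N).mkQ w)) (w : V)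
      ∈ N' := by
  have h := mk_evalAt hN hN'
    (semiCharOf (subquotientPhi φ N N' hN hN') ((N'.submoduleOf N).mkQ w)) w
  rw [evalAt_semiCharOf ha, Submodule.mkQ_apply, Submodule.Quotient.mk_eq_zero,
    mem_submoduleOf_iff, coe_evalAt_restrictPhi] at h
  exact h

theorem semiCharOf_restrictPhi (ha : 1 ≤ a) {N N' : Submodule K V} (hN : IsStable φ N)
    (hN' : IsStable φ N') (h : N' ≤ N) {w : N} {y : N'}
    (hy : (y : V) =
      evalAt φ (semiCharOf (subquotientPhi φ N N' hN hN') ((N'.submoduleOf N).mkQ w)) (w : V)) :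
    semiCharOf (restrictPhi φ N hN) w = semiCharOf (restrictPhi φ N' hN') y *
      semiCharOf (subquotientPhi φ N N' hN hN') ((N'.submoduleOf N).mkQ w) := by
  refine semiCharOf_of_exact ha (Submodule.inclusion_injective h) (Submodule.mkQ_surjective _)
    (exact_inclusion_mkQ h) (fun _ => rfl) (fun _ => rfl) ?_
  ext
  rw [coe_evalAt_restrictPhi]
  exact hy

omit [FiniteDimensional K V] in
theorem Generates.subquotientPhi {N N' : Submodule K V} (hN : IsStable φ N)
    (hN' : IsStable φ N') {w : N} (hw : Generates (restrictPhi φ N hN) w) :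
    Generates (subquotientPhi φ N N' hN hN') ((N'.submoduleOf N).mkQ w) :=
  hw.map (Submodule.mkQ_surjective _) fun _ => rfl

theorem Generates.restrictPhi (ha : 1 ≤ a) {N N' : Submodule K V} (hN : IsStable φ N)
    (hN' : IsStable φ N') (h : N' ≤ N) {w : N} {y : N'}
    (hy : (y : V) =
      evalAt φ (semiCharOf (PhiModule.subquotientPhi φ N N' hN hN') ((N'.submoduleOf N).mkQ w))
        (w : V))
    (hw : Generates (restrictPhi φ N hN) w) : Generates (PhiModule.restrictPhi φ N' hN') y := by
  refine Generates.of_exact hw (Submodule.inclusion_injective h) (Submodule.mkQ_surjective _)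
    (exact_inclusion_mkQ h) (fun _ => rfl)
    (φ'' := PhiModule.subquotientPhi φ N N' hN hN') (fun _ => rfl) ?_ ha
  ext
  rw [← toPoly_semiCharOf, ← evalAt_eq_act, coe_evalAt_restrictPhi]
  exact hy

/-- A basis transported along f has the same matrix and coordinates, so independence of the basis
concludes. -/
theorem semiCharOf_equiv (ha : 1 ≤ a) {W : Type*} [AddCommGroup W] [Module K W]
    [FiniteDimensional K W] {ψ : W →ₛₗ[iterateFrobenius K p a] W} (f : V ≃ₗ[K] W)
    (h : ∀ v, f (φ v) = ψ (f v)) (x : V) : semiCharOf ψ (f x) = semiCharOf φ x := by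
  rw [← semiChar_eq_semiCharOf ha ((finBasis K V).map f), semiCharOf]
  simp [semiChar, ← h]

/-- A `φ`-module with an irreducible semi-characteristic polynomial is simple. -/
theorem isSimplePhi_of_irreducible (ha : 1 ≤ a) {x : V} (h : Irreducible (semiCharOf φ x)) :
    IsSimplePhi φ := by
  rw [irreducible_iff_deg (monic_semiCharOf φ x).ne_zero, deg_semiCharOf] at h
  refine ⟨Module.finrank_pos_iff (R := K).1 (Nat.pos_of_ne_zero h.1), fun N hN => ?_⟩
  let φ'' : (V ⧸ N) →ₛₗ[iterateFrobenius K p a] (V ⧸ N) := Submodule.mapQ N N φ hN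
  have hker : evalAt φ (semiCharOf φ'' (N.mkQ x)) x ∈ N := by
    have := map_evalAt (ψ := φ'') N.mkQ (fun _ => rfl) (semiCharOf φ'' (N.mkQ x)) x
    rw [evalAt_semiCharOf ha, Submodule.mkQ_apply, Submodule.Quotient.mk_eq_zero] at this
    exact this
  -- The two factors have degrees dim N and dim V/N, so irreducibility makes one of these dimensions
  -- zero. Nothing is required of x.
  have hmul : semiCharOf φ x = semiCharOf (restrictPhi φ N hN) ⟨_, hker⟩ *
      semiCharOf φ'' (N.mkQ x) :=
    semiCharOf_of_exact ha (i := N.subtype) N.injective_subtype (Submodule.mkQ_surjective N)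
      (LinearMap.exact_subtype_mkQ N) (fun _ => rfl) (fun _ => rfl) rfl
  rcases h.2 _ _ hmul with h0 | h0
  · rw [deg_semiCharOf, Submodule.finrank_eq_zero] at h0
    exact Or.inl h0
  · rw [deg_semiCharOf] at h0
    refine Or.inr (Submodule.eq_top_of_finrank_eq ?_)
    have := N.finrank_quotient_add_finrank
    omega

end Subquotient

/-! ### Ordered products -/

section DescProd

variable {M : Type*} [Monoid M]

theorem prod_reverse_take_ofFn_succ {m : ℕ} (π : Fin m → M) (i : Fin m) :
    ((List.ofFn π).take (i + 1)).reverse.prod = π i * ((List.ofFn π).take i).reverse.prod := by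
  rw [List.take_succ_eq_append_getElem (by simp)]
  simp

end DescProd

/-! ### Jordan–Hölder sequences and factorizations -/

namespace JHSeq

open Module SkewPoly

variable {K : Type*} [Field K] {p a : ℕ} [Fact p.Prime] [CharP K p]
  {V : Type*} [AddCommGroup V] [Module K V] [FiniteDimensional K V]
  {φ : V →ₛₗ[iterateFrobenius K p a] V} {m : ℕ}

/-- The points `(π_{i-1} ⋯ π_0)(φ)(x)` of the terms of a Jordan–Hölder sequence. -/
def point (ha : 1 ≤ a) (S : JHSeq φ m) (x : V) : ∀ i, S.D i :=
  Fin.induction (motive := fun i => S.D i) ⟨x, by rw [S.top]; trivial⟩ fun i z =>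
    ⟨evalAt φ (semiCharOf (S.factorPhi i) (((S.D i.succ).submoduleOf (S.D i.castSucc)).mkQ z)) z,
      evalAt_semiCharOf_mem ha (S.stable i.castSucc) (S.stable i.succ) z⟩

/-- The class of a point in the composition factor. -/
def classPoint (ha : 1 ≤ a) (S : JHSeq φ m) (x : V) (i : Fin m) : S.Factor i :=
  ((S.D i.succ).submoduleOf (S.D i.castSucc)).mkQ (S.point ha x i.castSucc)

/-- The semi-characteristic polynomials of the composition factors in the classes of the points. -/
def factorChar (ha : 1 ≤ a) (S : JHSeq φ m) (x : V) (i : Fin m) : SkewPoly K p a :=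
  semiCharOf (S.factorPhi i) (S.classPoint ha x i)

variable (ha : 1 ≤ a) (S : JHSeq φ m) (x : V)

theorem coe_point_zero : (S.point ha x 0 : V) = x := rfl

theorem coe_point_succ (i : Fin m) :
    (S.point ha x i.succ : V) = evalAt φ (S.factorChar ha x i) (S.point ha x i.castSucc) := rfl

/-- The recursion defining `point` carries membership in D_i; this is the closed form that
`IsFactorData` asks for. -/
theorem coe_point (i : Fin (m + 1)) : (S.point ha x i : V) =
    evalAt φ ((List.ofFn (S.factorChar ha x)).take i).reverse.prod x := by
  induction i using Fin.induction with
  | zero =>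
    rw [coe_point_zero]
    simp [evalAt_one]
  | succ i ih =>
    rw [coe_point_succ, ih, Fin.val_succ, prod_reverse_take_ofFn_succ, evalAt_mul]
    rfl

/-- The invariant of the induction: each step splits the polynomial of D_i by multiplicativity for
D_{i+1} ⊂ D_i. At i = m the first factor is monic of degree 0, hence 1. -/
theorem semiCharOf_point_mul (i : Fin (m + 1)) :
    semiCharOf (restrictPhi φ (S.D i) (S.stable i)) (S.point ha x i) *
      ((List.ofFn (S.factorChar ha x)).take i).reverse.prod = semiCharOf φ x := by
  induction i using Fin.induction with
  | zero =>
    rw [← semiCharOf_equiv ha (φ := restrictPhi φ (S.D 0) (S.stable 0)) (ψ := φ)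
      (LinearEquiv.ofTop (S.D 0) S.top) (fun _ => rfl) (S.point ha x 0)]
    simp only [Fin.val_zero, List.take_zero, List.reverse_nil, List.prod_nil, mul_one]
    rfl
  | succ i ih =>
    rw [Fin.val_succ, prod_reverse_take_ofFn_succ, ← mul_assoc, ← ih]
    congr 1
    exact (semiCharOf_restrictPhi ha (S.stable i.castSucc) (S.stable i.succ) (S.le i)
      (S.coe_point_succ ha x i)).symm

theorem descProd_factorChar : descProd (S.factorChar ha x) = semiCharOf φ x := by
  rw [← S.semiCharOf_point_mul ha x (Fin.last m)]
  have h : semiCharOf (restrictPhi φ (S.D (Fin.last m)) (S.stable (Fin.last m)))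
      (S.point ha x (Fin.last m)) = 1 := by
    refine (monic_semiCharOf _ _).eq_one ?_
    rw [deg_semiCharOf, S.bot, finrank_bot]
  rw [h, one_mul, descProd, Fin.val_last, List.take_of_length_le (by simp)]

theorem isFactorData : S.IsFactorData x (S.classPoint ha x) (S.factorChar ha x) := fun i =>
  ⟨⟨S.point ha x i.castSucc, S.coe_point ha x i.castSucc, rfl⟩,
    fun _ c => (semiChar_eq_semiCharOf ha c _ _).symm⟩

theorem irreducible_factorChar {i : Fin m}
    (h : S.classPoint ha x i ≠ 0 ∨ finrank K (S.Factor i) = 1) :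
    Irreducible (S.factorChar ha x i) := by
  rcases h with h | h
  · exact (S.simple i).irreducible_semiCharOf ha h
  · exact irreducible_semiCharOf_of_finrank_eq_one _ _ h

variable {x}

theorem generates_point (hx : Generates φ x) (i : Fin (m + 1)) :
    Generates (restrictPhi φ (S.D i) (S.stable i)) (S.point ha x i) := by
  induction i using Fin.induction with
  | zero =>
    rw [generates_restrictPhi_iff, coe_point_zero, S.top]
    exact hx
  | succ i ih =>
    exact ih.restrictPhi ha _ _ (S.le i) (S.coe_point_succ ha x i)

theorem D_eq_cyc (hx : Generates φ x) (i : Fin (m + 1)) : S.D i = cyc φ (S.point ha x i : V) :=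
  ((generates_restrictPhi_iff (S.stable i) _).1 (S.generates_point ha hx i)).symm

theorem classPoint_ne_zero (hx : Generates φ x) (i : Fin m) : S.classPoint ha x i ≠ 0 := by
  have := (S.simple i).1
  exact ((S.generates_point ha hx i.castSucc).subquotientPhi _ (S.stable i.succ)).ne_zero

omit [FiniteDimensional K V] in
theorem ext_D {S S' : JHSeq φ m} (h : S.D = S'.D) : S = S' := by
  cases S
  cases S'
  cases h
  rfl

/-- The term D_i is spanned by the iterates of its point, and by `coe_point` that point depends only
on x and the factors. -/
theorem factorChar_injective (hx : Generates φ x) :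
    Function.Injective fun S : JHSeq φ m => S.factorChar ha x := by
  intro S S' h
  simp only at h
  refine ext_D (funext fun i => ?_)
  rw [S.D_eq_cyc ha hx, S'.D_eq_cyc ha hx, coe_point, coe_point, h]

/-- The sequence is forced by `D_eq_cyc`: D_i must be generated by (ρ_{i-1}⋯ρ_0)(φ)(x). A dimension
count shows that the ρ_i are the semi-characteristic polynomials of the quotients, which are then
simple by irreducibility. -/
theorem exists_factorChar_eq (hx : Generates φ x) (ρ : Fin m → SkewPoly K p a)
    (hρ : ∀ i, (ρ i).Monic ∧ Irreducible (ρ i)) (hprod : semiCharOf φ x = descProd ρ) :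
    ∃ S : JHSeq φ m, S.factorChar ha x = ρ := by
  let pp : ℕ → SkewPoly K p a := fun k => ((List.ofFn ρ).take k).reverse.prod
  let pt : ℕ → V := fun k => evalAt φ (pp k) x
  have pp_succ : ∀ i : Fin m, pp (i + 1) = ρ i * pp i := prod_reverse_take_ofFn_succ ρ
  have pp_zero : pp 0 = 1 := by simp [pp]
  have pp_last : pp m = semiCharOf φ x := by
    rw [hprod, descProd]
    simp only [pp]
    rw [List.take_of_length_le (by simp)]
  have pt_succ : ∀ i : Fin m, pt (i + 1) = evalAt φ (ρ i) (pt i) := fun i => by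
    simp only [pt]
    rw [pp_succ, evalAt_mul]
  have pt_zero : pt 0 = x := by simp only [pt]; rw [pp_zero, evalAt_one]
  have pt_last : pt m = 0 := by simp only [pt]; rw [pp_last, evalAt_semiCharOf ha]
  have pp_monic : ∀ i : Fin (m + 1), (pp i).Monic := by
    intro i
    induction i using Fin.induction with
    | zero => exact pp_zero ▸ monic_one
    | succ i ih =>
      rw [Fin.val_succ, pp_succ]
      exact (hρ i).1.mul ih
  have deg_pp_succ : ∀ i : Fin m, (pp (i + 1)).deg = (ρ i).deg + (pp i).deg := fun i => by
    rw [pp_succ]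
    exact (mul_ne_zero_and_deg_mul (hρ i).1.ne_zero (pp_monic i.castSucc).ne_zero).2
  let D : Fin (m + 1) → Submodule K V := fun i => cyc φ (pt i)
  have stable : ∀ i, IsStable φ (D i) := fun i => isStable_cyc φ _
  let z : ∀ i, D i := fun i => ⟨pt i, mem_cyc φ _⟩
  have gen_z : ∀ i, Generates (restrictPhi φ (D i) (stable i)) (z i) := fun i =>
    (generates_restrictPhi_iff _ _).2 rfl
  have le : ∀ i : Fin m, D i.succ ≤ D i.castSucc := fun i => by
    refine cyc_le (stable i.castSucc) ?_
    rw [Fin.val_succ, pt_succ]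
    exact evalAt_mem (stable i.castSucc) (mem_cyc φ _) _
  let ψ := fun i : Fin m =>
    subquotientPhi φ (D i.castSucc) (D i.succ) (stable i.castSucc) (stable i.succ)
  let y := fun i : Fin m => ((D i.succ).submoduleOf (D i.castSucc)).mkQ (z i.castSucc)
  have gen_y : ∀ i, Generates (ψ i) (y i) := fun i => (gen_z i.castSucc).subquotientPhi _ _
  have hy : ∀ i, evalAt (ψ i) (ρ i) (y i) = 0 := fun i => by
    rw [← mk_evalAt, Submodule.mkQ_apply, Submodule.Quotient.mk_eq_zero,
      mem_submoduleOf_iff, coe_evalAt_restrictPhi]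
    have : pt (i + 1) ∈ D i.succ := mem_cyc φ _
    rwa [pt_succ] at this
  -- The class `y i` generates the quotient and is killed by `ρ i`.
  have finrank_le : ∀ i : Fin m,
      finrank K (D i.castSucc ⧸ (D i.succ).submoduleOf (D i.castSucc)) ≤ (ρ i).deg := fun i => by
    have h := finrank_cyc_le ((monic_iff (ρ i)).1 (hρ i).1)
      ((evalAt_eq_act (ψ i) (ρ i) (y i)).symm.trans (hy i))
    rwa [show cyc (ψ i) (y i) = ⊤ from gen_y i, finrank_top] at h
  have finrank_add : ∀ i : Fin m,
      finrank K (D i.castSucc ⧸ (D i.succ).submoduleOf (D i.castSucc)) + finrank K (D i.succ) =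
        finrank K (D i.castSucc) := fun i => by
    rw [← ((D i.succ).submoduleOf (D i.castSucc)).finrank_quotient_add_finrank,
      (Submodule.submoduleOfEquivOfLe (le i)).finrank_eq]
  have top : D 0 = ⊤ := by
    simp only [D, Fin.val_zero, pt_zero]
    exact hx
  have bot : D (Fin.last m) = ⊥ := by
    simp only [D, Fin.val_last, pt_last]
    exact cyc_zero
  -- Each step raises g by deg ρ_i minus the dimension of the quotient, which is nonnegative. Since
  -- g equals dim V at both ends it is constant, and every bound in `finrank_le` is an equality.
  let g : Fin (m + 1) → ℕ := fun i => finrank K (D i) + (pp i).deg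
  have hg : Monotone g := Fin.monotone_iff_le_succ.2 fun i => by
    have h1 := finrank_le i
    have h2 := finrank_add i
    have h3 := deg_pp_succ i
    simp only [g, Fin.val_succ, Fin.val_castSucc]
    omega
  have hg_zero : g 0 = finrank K V := by
    have h : finrank K (D 0) = finrank K V := by rw [top, finrank_top]
    simp only [g, h, Fin.val_zero, pp_zero, deg_one, add_zero]
  have hg_last : g (Fin.last m) = finrank K V := by
    have h : finrank K (D (Fin.last m)) = 0 := by rw [bot, finrank_bot]
    simp only [g, h, Fin.val_last, pp_last, deg_semiCharOf, zero_add]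
  have hg_all : ∀ i, g i = finrank K V := fun i =>
    le_antisymm (hg_last ▸ hg (Fin.le_last i)) (hg_zero ▸ hg (Fin.zero_le i))
  have hρ_eq : ∀ i, ρ i = semiCharOf (ψ i) (y i) := fun i => by
    refine (gen_y i).eq_semiCharOf ha (hρ i).1 ?_ (hy i)
    have h1 := hg_all i.castSucc
    have h2 := hg_all i.succ
    have h3 := finrank_add i
    have h4 := deg_pp_succ i
    simp only [g, Fin.val_succ, Fin.val_castSucc] at h1 h2
    omega
  let S : JHSeq φ m :=
    { D := D
      stable := stable
      top := top
      bot := bot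
      le := le
      simple := fun i => isSimplePhi_of_irreducible ha (hρ_eq i ▸ (hρ i).2) }
  -- Points and factors are defined from each other. The implication at a single index lets the
  -- induction alternate: the i-th point gives the i-th factor, which gives the next point.
  have hchar : ∀ i : Fin m, S.point ha x i.castSucc = z i.castSucc → S.factorChar ha x i = ρ i := by
    intro i h
    rw [hρ_eq, factorChar, classPoint, h]
    rfl
  have hpoint : ∀ i, S.point ha x i = z i := by
    intro i
    induction i using Fin.induction with
    | zero => exact Subtype.ext ((coe_point_zero ha S x).trans pt_zero.symm)
    | succ i ih =>
      refine Subtype.ext ?_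
      rw [coe_point_succ, hchar i ih, ih]
      exact (pt_succ i).symm
  exact ⟨S, funext fun i => hchar i (hpoint _)⟩

end JHSeq

end PhiModule

end

/-! ### Assembly of the theorem -/

open PhiModule in
theorem mainTheorem3 (K : Type*) [Field K] (p a : ℕ) [Fact p.Prime] [CharP K p] (ha : 1 ≤ a)
    (V : Type*) [AddCommGroup V] [Module K V] [FiniteDimensional K V]
    (φ : V →ₛₗ[iterateFrobenius K p a] V) :
    (∀ d : ℕ, ∃! P : Fin d → GenericRing K d, IsUniversalCoeffs K (p ^ a) d P) ∧
    (∀ (m : ℕ) (S : JHSeq φ m) (x : V),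
      ∃ (y : ∀ i : Fin m, S.Factor i) (π : Fin m → SkewPoly K p a),
        S.IsFactorData x y π ∧
        (∀ (d : ℕ) (b : Module.Basis (Fin d) K V), semiChar b φ x = descProd π) ∧
        (∀ i, y i ≠ 0 ∨ Module.finrank K (S.Factor i) = 1 → Irreducible (π i)) ∧
        (Generates φ x → ∀ i, y i ≠ 0)) ∧
    (∀ x : V, Generates φ x → ∀ (d : ℕ) (b : Module.Basis (Fin d) K V) (m : ℕ),
      ∃ F : JHSeq φ m ≃ Factorization (semiChar b φ x) m,
        ∀ S : JHSeq φ m, ∃ y : ∀ i : Fin m, S.Factor i, S.IsFactorData x y (F S).1) := by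
  refine ⟨fun d => existsUnique_isUniversalCoeffs K p a d ha, fun m S x => ?_,
    fun x hx d b m => ?_⟩
  · refine ⟨S.classPoint ha x, S.factorChar ha x, S.isFactorData ha x, fun d b => ?_,
      fun i => S.irreducible_factorChar ha x, fun hx => S.classPoint_ne_zero ha hx⟩
    rw [semiChar_eq_semiCharOf ha, S.descProd_factorChar ha x]
  · let F : JHSeq φ m → Factorization (semiChar b φ x) m := fun S =>
      ⟨S.factorChar ha x, fun i => ⟨monic_semiCharOf _ _,
        S.irreducible_factorChar ha x (Or.inl (S.classPoint_ne_zero ha hx i))⟩, by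
        rw [semiChar_eq_semiCharOf ha, S.descProd_factorChar ha x]⟩
    have hF : Function.Bijective F := by
      refine ⟨fun S S' h => JHSeq.factorChar_injective ha hx (congrArg Subtype.val h), ?_⟩
      rintro ⟨ρ, hρ, hprod⟩
      rw [semiChar_eq_semiCharOf ha] at hprod
      obtain ⟨S, hS⟩ := JHSeq.exists_factorChar_eq ha hx ρ hρ hprod
      exact ⟨S, Subtype.ext hS⟩
    exact ⟨Equiv.ofBijective F hF, fun S => ⟨S.classPoint ha x, S.isFactorData ha x⟩⟩
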